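/- All Banach algebras are complex and need not be unital, and homomorphisms are $\mathbb{C}$-linear, multiplicative and not necessarily unital. For a Banach algebra $A$ let $A^+=\mathbb{C}\oplus A$ be its unitization. For a ring $R$ let $V(R)$ be the abelian semigroup of idempotents in matrices of all sizes over $R$ modulo Murray--von Neumann equivalence ($e\sim f$ if $e=xy$, $f=yx$ for some matrices $x,y$ over $R$), with $[e]+[f]=[\mathrm{diag}(e,f)]$, and let $K_{00}(R)$ be its Grothendieck group. Put $K_0(A)=\ker\big(K_{00}(A^+)\to K_{00}(\mathbb{C})\big)$ and $K_1(A)=\varinjlim_n GL_n^+(A)/GL_n^+(A)_0$, where $GL_n^+(A)$ is the group of $x\in GL_n(A^+)$ with $x\equiv 1$ modulo $M_n(A)$, $GL_n^+(A)_0$ is its connected component of the identity, and the maps are $x\mapsto \mathrm{diag}(x,1)$. (1) Let $I$ be a directed set and let $\big((A_i)_{i\in I},(\varphi_{j,i})_{i\le j}\big)$ be a direct system of Banach algebras with contractive homomorphisms. Then the direct limit $\varinjlim A_i$ exists in the category of Banach algebras and contractive homomorphisms, and the induced maps $$\varinjlim K_0(A_i)\to K_0\big(\varinjlim A_i\big),\qquad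 \varinjlim K_1(A_i)\to K_1\big(\varinjlim A_i\big)$$ are isomorphisms. (2) Let $P$ be the set of prime numbers, enumerated as $\{p_1,p_2,\ldots\}$. Let $N\colon P\to\mathbb{Z}_{\ge 0}\cup\{\infty\}$ be any function such that $\sum_{t\in P}N(t)=\infty$, and for $n\in\mathbb{Z}_{\ge0}$ define $$r(n)=p_1^{\min(N(p_1),n)}\,p_2^{\min(N(p_2),n)}\cdots p_n^{\min(N(p_n),n)}.$$ Let $p\in[1,\infty]$ and let $D$ be a spatial $L^p$ UHF algebra of type $N$, that is, a unital Banach algebra for which there are positive integers $s(0),s(1),\ldots$ with $s(0)=1$, $s(n)\mid s(n+1)$ for all $n$, and $N(t)=\sup\{m\in\mathbb{Z}_{\ge0}\colon t^m\mid s(n)\text{ for some }n\}$ for all $t\in P$, and unital subalgebras $D_0\subset D_1\subset\cdots\subset D$ with $\overline{\bigcup_n D_n}=D$ such that each $D_n$ is isometrically isomorphic to the algebra $M^p_{s(n)}$ of bounded operators on $L^p$ of a set with $s(n)$ points and normalized counting measure. Then $K_1(D)=0$ and there is an isomorphism $$K_0(D)\cong\bigcup_{n=1}^{\infty}r(n)^{-1}\mathbb{Z}\subset\mathbb{Q}$$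 which sends the class $[1_D]$ to $1\in\mathbb{Q}$. -/

import Mathlib

open scoped ENNReal

universe u v w

noncomputable section

/-! ### The semigroup of idempotents over a ring -/

/-- An idempotent square matrix of some finite size over `R`. -/
structure IdemMatrix (R : Type u) [NonUnitalRing R] where
  size : ℕ
  mat : Matrix (Fin size) (Fin size) R
  idem : mat * mat = mat

namespace IdemMatrix

variable {R : Type u} [NonUnitalRing R] {S : Type v} [NonUnitalRing S]

/-- Algebraic Murray-von Neumann equivalence: `e = x y` and `f = y x` for some (rectangular)
matrices `x`, `y` over `R`. -/
def Equivalent (e f : IdemMatrix R) : Prop :=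
  ∃ (x : Matrix (Fin e.size) (Fin f.size) R) (y : Matrix (Fin f.size) (Fin e.size) R),
    e.mat = x * y ∧ f.mat = y * x

theorem Equivalent.refl (e : IdemMatrix R) : e.Equivalent e :=
  ⟨e.mat, e.mat, e.idem.symm, e.idem.symm⟩

theorem Equivalent.symm {e f : IdemMatrix R} (h : e.Equivalent f) : f.Equivalent e := by
  obtain ⟨x, y, h1, h2⟩ := h
  exact ⟨y, x, h2, h1⟩

theorem Equivalent.trans {e f g : IdemMatrix R} (h : e.Equivalent f) (h' : f.Equivalent g) :
    e.Equivalent g := by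
  obtain ⟨x, y, h1, h2⟩ := h
  obtain ⟨z, w, h3, h4⟩ := h'
  refine ⟨x * z, w * y, ?_, ?_⟩
  · calc e.mat = e.mat * e.mat := e.idem.symm
      _ = x * (y * x) * y := by rw [h1]; simp only [Matrix.mul_assoc]
      _ = x * (z * w) * y := by rw [← h2, h3]
      _ = x * z * (w * y) := by simp only [Matrix.mul_assoc]
  · calc g.mat = g.mat * g.mat := g.idem.symm
      _ = w * (z * w) * z := by rw [h4]; simp only [Matrix.mul_assoc]
      _ = w * (y * x) * z := by rw [← h3, h2]
      _ = w * y * (x * z) := by simp only [Matrix.mul_assoc]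

instance setoid (R : Type u) [NonUnitalRing R] : Setoid (IdemMatrix R) where
  r := Equivalent
  iseqv := ⟨Equivalent.refl, Equivalent.symm, Equivalent.trans⟩

theorem equivalent_of_equiv {e f : IdemMatrix R} (σ : Fin e.size ≃ Fin f.size)
    (h : ∀ i j, f.mat (σ i) (σ j) = e.mat i j) : e.Equivalent f := by
  have hf : f.mat = e.mat.submatrix σ.symm σ.symm := by
    ext i j
    simpa using h (σ.symm i) (σ.symm j)
  refine ⟨e.mat.submatrix id σ.symm, e.mat.submatrix σ.symm id, ?_, ?_⟩
  · rw [Matrix.submatrix_mul_equiv, e.idem, Matrix.submatrix_id_id]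
  · rw [hf]
    have := Matrix.submatrix_mul_equiv e.mat e.mat σ.symm (Equiv.refl _) σ.symm
    rw [e.idem] at this
    exact this.symm

/-- The block diagonal sum `diag(e, f)`. -/
abbrev dsum (e f : IdemMatrix R) : IdemMatrix R where
  size := e.size + f.size
  mat := (Matrix.fromBlocks e.mat 0 0 f.mat).submatrix finSumFinEquiv.symm finSumFinEquiv.symm
  idem := by
    rw [Matrix.submatrix_mul_equiv, Matrix.fromBlocks_multiply]
    simp [e.idem, f.idem]

theorem dsum_congr {e e' f f' : IdemMatrix R} (h : e.Equivalent e') (h' : f.Equivalent f') :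
    (e.dsum f).Equivalent (e'.dsum f') := by
  obtain ⟨x, y, h1, h2⟩ := h
  obtain ⟨z, w, h3, h4⟩ := h'
  refine ⟨(Matrix.fromBlocks x 0 0 z).submatrix finSumFinEquiv.symm finSumFinEquiv.symm,
    (Matrix.fromBlocks y 0 0 w).submatrix finSumFinEquiv.symm finSumFinEquiv.symm, ?_, ?_⟩
  · rw [Matrix.submatrix_mul_equiv, Matrix.fromBlocks_multiply]
    simp [dsum, h1, h3]
  · rw [Matrix.submatrix_mul_equiv, Matrix.fromBlocks_multiply]
    simp [dsum, h2, h4]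

/-- The empty matrix. -/
abbrev zero (R : Type u) [NonUnitalRing R] : IdemMatrix R := ⟨0, 0, by simp⟩

theorem zero_dsum (e : IdemMatrix R) : ((zero R).dsum e).Equivalent e := by
  refine Equivalent.symm (equivalent_of_equiv
    ((Equiv.emptySum (Fin 0) (Fin e.size)).symm.trans finSumFinEquiv) ?_)
  intro i j
  simp only [dsum, zero, Equiv.trans_apply, Matrix.submatrix_apply, Equiv.symm_apply_apply,
    Equiv.emptySum_symm_apply, Matrix.fromBlocks_apply₂₂]

theorem dsum_comm (e f : IdemMatrix R) : (e.dsum f).Equivalent (f.dsum e) := by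
  refine equivalent_of_equiv
    ((finSumFinEquiv.symm.trans (Equiv.sumComm _ _)).trans finSumFinEquiv) ?_
  intro i j
  obtain ⟨i, rfl⟩ := finSumFinEquiv.surjective i
  obtain ⟨j, rfl⟩ := finSumFinEquiv.surjective j
  rcases i with i | i <;> rcases j with j | j <;>
    simp only [dsum, Equiv.trans_apply, Equiv.symm_apply_apply, Matrix.submatrix_apply,
      Equiv.sumComm_apply, Sum.swap_inl, Sum.swap_inr, Matrix.fromBlocks_apply₁₁,
      Matrix.fromBlocks_apply₁₂, Matrix.fromBlocks_apply₂₁, Matrix.fromBlocks_apply₂₂,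
      Matrix.zero_apply]

theorem dsum_assoc (e f g : IdemMatrix R) :
    ((e.dsum f).dsum g).Equivalent (e.dsum (f.dsum g)) := by
  refine equivalent_of_equiv
    (((finSumFinEquiv.symm.trans (Equiv.sumCongr finSumFinEquiv.symm (Equiv.refl _))).trans
      (Equiv.sumAssoc _ _ _)).trans
      ((Equiv.sumCongr (Equiv.refl _) finSumFinEquiv).trans finSumFinEquiv)) ?_
  intro i j
  obtain ⟨i, rfl⟩ := finSumFinEquiv.surjective i
  obtain ⟨j, rfl⟩ := finSumFinEquiv.surjective j
  rcases i with i | i <;> rcases j with j | j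
  · obtain ⟨i, rfl⟩ := finSumFinEquiv.surjective i
    obtain ⟨j, rfl⟩ := finSumFinEquiv.surjective j
    rcases i with i | i <;> rcases j with j | j <;>
      simp [-finSumFinEquiv_apply_left, -finSumFinEquiv_apply_right]
  · obtain ⟨i, rfl⟩ := finSumFinEquiv.surjective i
    rcases i with i | i <;>
      simp [-finSumFinEquiv_apply_left, -finSumFinEquiv_apply_right]
  · obtain ⟨j, rfl⟩ := finSumFinEquiv.surjective j
    rcases j with j | j <;>
      simp [-finSumFinEquiv_apply_left, -finSumFinEquiv_apply_right]
  · simp [-finSumFinEquiv_apply_left, -finSumFinEquiv_apply_right]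

/-- Entrywise application of a ring homomorphism. -/
abbrev map (f : R →ₙ+* S) (e : IdemMatrix R) : IdemMatrix S where
  size := e.size
  mat := e.mat.map f
  idem := by
    conv_rhs => rw [← e.idem]
    ext i j
    simp [Matrix.mul_apply]

theorem map_congr (f : R →ₙ+* S) {e e' : IdemMatrix R} (h : e.Equivalent e') :
    (e.map f).Equivalent (e'.map f) := by
  obtain ⟨x, y, h1, h2⟩ := h
  refine ⟨x.map f, y.map f, ?_, ?_⟩
  · ext i j
    simp [map, h1, Matrix.mul_apply]
  · ext i j
    simp [map, h2, Matrix.mul_apply]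

theorem map_dsum (f : R →ₙ+* S) (e e' : IdemMatrix R) :
    (e.dsum e').map f = (e.map f).dsum (e'.map f) := by
  simp only [map, dsum, mk.injEq, heq_eq_eq, true_and]
  ext i j
  simp only [Matrix.map_apply, Matrix.submatrix_apply]
  rcases finSumFinEquiv.symm i with a | a <;> rcases finSumFinEquiv.symm j with b | b <;> simp

/-- The `1 × 1` matrix with entry an idempotent element. -/
def single (e : R) (he : e * e = e) : IdemMatrix R :=
  ⟨1, Matrix.of fun _ _ => e, by ext i j; simp [Matrix.mul_apply, he]⟩

end IdemMatrix

/-- The semigroup `V(R)` of equivalence classes of idempotents in matrix algebras over `R`. -/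
def VMonoid (R : Type u) [NonUnitalRing R] : Type u := Quotient (IdemMatrix.setoid R)

namespace VMonoid

variable {R : Type u} [NonUnitalRing R] {S : Type v} [NonUnitalRing S]
  {T : Type w} [NonUnitalRing T]

def mk (e : IdemMatrix R) : VMonoid R := Quotient.mk _ e

instance : Add (VMonoid R) :=
  ⟨Quotient.map₂ IdemMatrix.dsum (fun _ _ h _ _ h' => IdemMatrix.dsum_congr h h')⟩

instance : Zero (VMonoid R) := ⟨mk (IdemMatrix.zero R)⟩

instance : AddCommMonoid (VMonoid R) where
  nsmul := nsmulRec
  add_assoc := by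
    rintro ⟨a⟩ ⟨b⟩ ⟨c⟩
    exact Quotient.sound (IdemMatrix.dsum_assoc a b c)
  add_comm := by
    rintro ⟨a⟩ ⟨b⟩
    exact Quotient.sound (IdemMatrix.dsum_comm a b)
  zero_add := by
    rintro ⟨a⟩
    exact Quotient.sound (IdemMatrix.zero_dsum a)
  add_zero := by
    rintro ⟨a⟩
    exact Quotient.sound ((IdemMatrix.dsum_comm _ _).trans (IdemMatrix.zero_dsum a))

def map (f : R →ₙ+* S) : VMonoid R →+ VMonoid S where
  toFun := Quotient.map (IdemMatrix.map f) (fun _ _ h => IdemMatrix.map_congr f h)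
  map_zero' := Quotient.sound (IdemMatrix.equivalent_of_equiv (Equiv.refl (Fin 0))
    (fun i => i.elim0))
  map_add' := by
    rintro ⟨a⟩ ⟨b⟩
    exact congrArg mk (IdemMatrix.map_dsum f a b)

theorem map_id : map (NonUnitalRingHom.id R) = AddMonoidHom.id (VMonoid R) := by
  ext ⟨a⟩
  rfl

theorem map_comp (g : S →ₙ+* T) (f : R →ₙ+* S) : map (g.comp f) = (map g).comp (map f) := by
  ext ⟨a⟩
  rfl

theorem map_zero_hom : map (0 : R →ₙ+* S) = 0 := by
  ext ⟨a⟩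
  refine Quotient.sound ⟨0, 0, ?_, ?_⟩
  · ext i j
    simp [IdemMatrix.map]
  · ext i
    exact Fin.elim0 i

end VMonoid

/-- `K₀₀(R)`, the Grothendieck group of `V(R)`. -/
abbrev K00 (R : Type u) [NonUnitalRing R] : Type u := Algebra.GrothendieckAddGroup (VMonoid R)

namespace K00

variable {R : Type u} [NonUnitalRing R] {S : Type v} [NonUnitalRing S]
  {T : Type w} [NonUnitalRing T]

def map (f : R →ₙ+* S) : K00 R →+ K00 S :=
  Algebra.GrothendieckAddGroup.lift (Algebra.GrothendieckAddGroup.of.comp (VMonoid.map f))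

theorem map_of (f : R →ₙ+* S) (x : VMonoid R) :
    map f (Algebra.GrothendieckAddGroup.of x) =
      Algebra.GrothendieckAddGroup.of (VMonoid.map f x) :=
  DFunLike.congr_fun (Algebra.GrothendieckAddGroup.lift.symm_apply_apply
    (Algebra.GrothendieckAddGroup.of.comp (VMonoid.map f))) x

theorem hom_ext {G : Type*} [AddCommGroup G] {f g : K00 R →+ G}
    (h : ∀ x, f (Algebra.GrothendieckAddGroup.of x) = g (Algebra.GrothendieckAddGroup.of x)) :
    f = g :=
  Algebra.GrothendieckAddGroup.lift.symm.injective (AddMonoidHom.ext h)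

theorem map_id : map (NonUnitalRingHom.id R) = AddMonoidHom.id (K00 R) :=
  hom_ext fun x => by rw [map_of, VMonoid.map_id]; rfl

theorem map_comp (g : S →ₙ+* T) (f : R →ₙ+* S) : map (g.comp f) = (map g).comp (map f) :=
  hom_ext fun x => by simp only [AddMonoidHom.comp_apply, map_of, VMonoid.map_comp]

end K00

/-! ### Contractive homomorphisms and the unitization -/

/-- Contractive (not necessarily unital) homomorphisms of complex normed algebras. -/
structure ContrHom (A : Type u) (B : Type v) [NonUnitalNormedRing A] [NormedSpace ℂ A]
    [NonUnitalNormedRing B] [NormedSpace ℂ B] extends A →ₙₐ[ℂ] B where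
  norm_le : ∀ a, ‖toFun a‖ ≤ ‖a‖

section Unitization

variable {A : Type u} [NonUnitalNormedRing A] [NormedSpace ℂ A]
  {B : Type v} [NonUnitalNormedRing B] [NormedSpace ℂ B]
  {C : Type w} [NonUnitalNormedRing C] [NormedSpace ℂ C]

namespace ContrHom

instance : FunLike (ContrHom A B) A B where
  coe f := f.toFun
  coe_injective f g h := by
    rcases f with ⟨f, _⟩
    rcases g with ⟨g, _⟩
    have : f = g := DFunLike.coe_injective h
    subst this
    rfl

instance : NonUnitalAlgHomClass (ContrHom A B) ℂ A B where
  map_add f := f.toNonUnitalAlgHom.map_add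
  map_zero f := f.toNonUnitalAlgHom.map_zero
  map_mul f := f.toNonUnitalAlgHom.map_mul
  map_smulₛₗ f := f.toNonUnitalAlgHom.map_smul

theorem norm_apply_le (f : ContrHom A B) (a : A) : ‖f a‖ ≤ ‖a‖ := f.norm_le a

theorem continuous (f : ContrHom A B) : Continuous f :=
  AddMonoidHomClass.continuous_of_bound f 1 (fun a => by
    rw [one_mul]
    exact f.norm_le a)

def id (A : Type u) [NonUnitalNormedRing A] [NormedSpace ℂ A] : ContrHom A A :=
  ⟨NonUnitalAlgHom.id ℂ A, fun _ => le_rfl⟩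

def comp (g : ContrHom B C) (f : ContrHom A B) : ContrHom A C :=
  ⟨g.toNonUnitalAlgHom.comp f.toNonUnitalAlgHom,
    fun a => (g.norm_le (f a)).trans (f.norm_le a)⟩

end ContrHom

/-- The unitization `A⁺ = ℂ ⊕ A` (a unit is adjoined even if `A` has one), a normed algebra with
`‖(λ, a)‖ = |λ| + ‖a‖`. -/
abbrev Plus (A : Type u) [NonUnitalNormedRing A] [NormedSpace ℂ A] : Type u :=
  WithLp 1 (Unitization ℂ A)

namespace Plus

variable [IsScalarTower ℂ A A] [SMulCommClass ℂ A A] [IsScalarTower ℂ B B] [SMulCommClass ℂ B B]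
  [IsScalarTower ℂ C C] [SMulCommClass ℂ C C]

/-- The quotient map `A⁺ → ℂ`. -/
def scalar (A : Type u) [NonUnitalNormedRing A] [NormedSpace ℂ A] [IsScalarTower ℂ A A]
    [SMulCommClass ℂ A A] : Plus A →+* ℂ where
  toFun x := (WithLp.ofLp x).fst
  map_one' := rfl
  map_mul' _ _ := rfl
  map_zero' := rfl
  map_add' _ _ := rfl

/-- The inclusion `A → A⁺`. -/
def inr (A : Type u) [NonUnitalNormedRing A] [NormedSpace ℂ A] [IsScalarTower ℂ A A]
    [SMulCommClass ℂ A A] : A →ₙ+* Plus A where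
  toFun a := WithLp.toLp 1 (a : Unitization ℂ A)
  map_mul' a b := congrArg (WithLp.toLp 1) (Unitization.inr_mul ℂ a b)
  map_zero' := rfl
  map_add' a b := congrArg (WithLp.toLp 1) (Unitization.inr_add ℂ a b)

/-- The unital homomorphism `(λ, a) ↦ (λ, φ a)` induced by `φ`. -/
def map (φ : ContrHom A B) : Plus A →+* Plus B where
  toFun x := WithLp.toLp 1
    (Unitization.inl (WithLp.ofLp x).fst + (φ (WithLp.ofLp x).snd : Unitization ℂ B))
  map_one' := by
    refine WithLp.ofLp_injective 1 (Unitization.ext ?_ ?_)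
    · change (1 : ℂ) + 0 = 1
      simp
    · change 0 + φ 0 = 0
      simp
  map_mul' x y := by
    refine WithLp.ofLp_injective 1 (Unitization.ext ?_ ?_) <;> simp
  map_zero' := by
    refine WithLp.ofLp_injective 1 (Unitization.ext ?_ ?_) <;> simp
  map_add' x y := by
    refine WithLp.ofLp_injective 1 (Unitization.ext ?_ ?_) <;> simp

theorem map_id : map (ContrHom.id A) = RingHom.id (Plus A) := by
  ext x
  refine WithLp.ofLp_injective 1 (Unitization.ext ?_ ?_)
  · simp [map]
  · simp [map]
    rfl

theorem map_comp (ψ : ContrHom B C) (φ : ContrHom A B) :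
    map (ψ.comp φ) = (map ψ).comp (map φ) := by
  ext x
  refine WithLp.ofLp_injective 1 (Unitization.ext ?_ ?_)
  · simp [map]
  · simp [map]
    rfl

theorem scalar_comp_map (φ : ContrHom A B) : (scalar B).comp (map φ) = scalar A := by
  ext x
  change (WithLp.ofLp x).fst + 0 = (WithLp.ofLp x).fst
  simp

theorem continuous_map (φ : ContrHom A B) : Continuous (map φ) := by
  refine AddMonoidHomClass.continuous_of_bound (map φ) 1 (fun x => ?_)
  rw [WithLp.unitization_norm_def, WithLp.unitization_norm_def, one_mul]
  simpa [map] using φ.norm_apply_le _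

end Plus
/-! ### The group `K₀` -/

section K0

variable [IsScalarTower ℂ A A] [SMulCommClass ℂ A A] [IsScalarTower ℂ B B] [SMulCommClass ℂ B B]
  [IsScalarTower ℂ C C] [SMulCommClass ℂ C C]

/-- `K₀(A)`, the kernel of `K₀₀(A⁺) → K₀₀(ℂ)`. -/
def K0 (A : Type u) [NonUnitalNormedRing A] [NormedSpace ℂ A] [IsScalarTower ℂ A A]
    [SMulCommClass ℂ A A] : Type u :=
  (K00.map (Plus.scalar A : Plus A →ₙ+* ℂ)).ker

namespace K0

instance : AddCommGroup (K0 A) :=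
  inferInstanceAs (AddCommGroup (K00.map (Plus.scalar A : Plus A →ₙ+* ℂ)).ker)

/-- The homomorphism `K₀(A) → K₀(B)` induced by `φ`. -/
def map (φ : ContrHom A B) : K0 A →+ K0 B :=
  ((K00.map (Plus.map φ : Plus A →ₙ+* Plus B)).comp
    (K00.map (Plus.scalar A : Plus A →ₙ+* ℂ)).ker.subtype).codRestrict
      (K00.map (Plus.scalar B : Plus B →ₙ+* ℂ)).ker (fun x => by
        have h : (Plus.scalar B : Plus B →ₙ+* ℂ).comp (Plus.map φ : Plus A →ₙ+* Plus B) =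
            (Plus.scalar A : Plus A →ₙ+* ℂ) :=
          NonUnitalRingHom.ext fun y => DFunLike.congr_fun (Plus.scalar_comp_map φ) y
        have h2 := DFunLike.congr_fun
          (K00.map_comp (Plus.scalar B : Plus B →ₙ+* ℂ) (Plus.map φ : Plus A →ₙ+* Plus B)) x.1
        rw [h] at h2
        exact h2.symm.trans x.2)

theorem map_id (x : K0 A) : map (ContrHom.id A) x = x := by
  apply Subtype.ext
  change K00.map (Plus.map (ContrHom.id A) : Plus A →ₙ+* Plus A) x.1 = x.1
  rw [Plus.map_id]
  exact DFunLike.congr_fun K00.map_id x.1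

theorem map_comp (ψ : ContrHom B C) (φ : ContrHom A B) (x : K0 A) :
    map (ψ.comp φ) x = map ψ (map φ x) := by
  apply Subtype.ext
  change K00.map (Plus.map (ψ.comp φ) : Plus A →ₙ+* Plus C) x.1 = _
  rw [Plus.map_comp]
  exact DFunLike.congr_fun
    (K00.map_comp (Plus.map ψ : Plus B →ₙ+* Plus C) (Plus.map φ : Plus A →ₙ+* Plus B)) x.1

/-- The class in `K₀(A)` of an idempotent `e ∈ A`. -/
def idemClass (e : A) (he : e * e = e) : K0 A :=
  ⟨Algebra.GrothendieckAddGroup.of (VMonoid.mk ((IdemMatrix.single e he).map (Plus.inr A))), by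
    change K00.map (Plus.scalar A : Plus A →ₙ+* ℂ) (Algebra.GrothendieckAddGroup.of
      (VMonoid.map (Plus.inr A) (VMonoid.mk (IdemMatrix.single e he)))) = 0
    have h : (Plus.scalar A : Plus A →ₙ+* ℂ).comp (Plus.inr A) = 0 := rfl
    have h2 := DFunLike.congr_fun (VMonoid.map_comp (Plus.scalar A : Plus A →ₙ+* ℂ) (Plus.inr A))
      (VMonoid.mk (IdemMatrix.single e he))
    rw [h, VMonoid.map_zero_hom] at h2
    rw [K00.map_of]
    exact (congrArg Algebra.GrothendieckAddGroup.of h2.symm).trans (map_zero _)⟩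

end K0

end K0

/-! ### The group `K₁` -/

/-- The monoid homomorphism `a ↦ diag(a, 1)` from `n × n` to `m × m` matrices, for `n ≤ m`. -/
def matrixStab (R : Type u) [Ring R] {n m : ℕ} (h : n ≤ m) :
    Matrix (Fin n) (Fin n) R →* Matrix (Fin m) (Fin m) R where
  toFun a := Matrix.of fun i j =>
    if hij : i.1 < n ∧ j.1 < n then a ⟨i.1, hij.1⟩ ⟨j.1, hij.2⟩ else if i = j then 1 else 0
  map_one' := by
    ext i j
    by_cases hij : i.1 < n ∧ j.1 < n <;> simp [Matrix.one_apply, Fin.ext_iff]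
  map_mul' a b := by
    obtain ⟨k, rfl⟩ := Nat.exists_eq_add_of_le h
    ext i j
    have h1 : ∀ (x : Fin n) (y : Fin k), Fin.castAdd k x ≠ Fin.natAdd n y := fun x y hxy => by
      have := congrArg Fin.val hxy
      simp only [Fin.val_castAdd, Fin.val_natAdd] at this
      omega
    have h2 : ∀ (x : Fin n) (y : Fin k), Fin.natAdd n y ≠ Fin.castAdd k x :=
      fun x y hxy => h1 x y hxy.symm
    rw [Matrix.mul_apply, Fin.sum_univ_add]
    induction i using Fin.addCases <;> induction j using Fin.addCases <;>
      simp [Matrix.mul_apply, h1, h2]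

theorem matrixStab_refl (R : Type u) [Ring R] {n : ℕ} (a : Matrix (Fin n) (Fin n) R) :
    matrixStab R le_rfl a = a := by
  ext i j
  simp [matrixStab]

theorem matrixStab_trans (R : Type u) [Ring R] {n m k : ℕ} (h : n ≤ m) (h' : m ≤ k)
    (a : Matrix (Fin n) (Fin n) R) :
    matrixStab R h' (matrixStab R h a) = matrixStab R (h.trans h') a := by
  ext i j
  simp only [matrixStab, MonoidHom.coe_mk, OneHom.coe_mk, Matrix.of_apply, Fin.ext_iff]
  by_cases h1 : i.1 < n ∧ j.1 < n
  · have h2 : i.1 < m ∧ j.1 < m := ⟨by omega, by omega⟩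
    simp [h1, h2]
  · by_cases h2 : i.1 < m ∧ j.1 < m <;> simp [h1, h2]

theorem continuous_matrixStab (R : Type u) [Ring R] [TopologicalSpace R] {n m : ℕ} (h : n ≤ m) :
    Continuous (matrixStab R h) := by
  refine continuous_matrix fun i j => ?_
  by_cases hij : i.1 < n ∧ j.1 < n
  · simpa [matrixStab, hij] using continuous_id.matrix_elem _ _
  · simpa [matrixStab, hij] using continuous_const

theorem matrixStab_map {R : Type u} [Ring R] {S : Type v} [Ring S] (f : R →+* S) {n m : ℕ}
    (h : n ≤ m) (a : Matrix (Fin n) (Fin n) R) :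
    (matrixStab R h a).map f = matrixStab S h (a.map f) := by
  ext i j
  by_cases hij : i.1 < n ∧ j.1 < n
  · simp [matrixStab, hij]
  · simp only [matrixStab, Matrix.map_apply, MonoidHom.coe_mk, OneHom.coe_mk, Matrix.of_apply,
      dif_neg hij]
    split_ifs <;> simp

instance connectedComponentOfOne_normal (G : Type u) [TopologicalSpace G] [Group G]
    [IsTopologicalGroup G] : (Subgroup.connectedComponentOfOne G).Normal where
  conj_mem x hx g := by
    have hc : Continuous fun y : G => g * y * g⁻¹ := by fun_prop
    have h := hc.image_connectedComponent_subset (1 : G)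
    rw [mul_one, mul_inv_cancel] at h
    exact h ⟨x, hx, rfl⟩

/-- A continuous homomorphism of topological groups induces a homomorphism on the quotients
by the connected components of the identity. -/
def pi0Map {G : Type u} {H : Type v} [TopologicalSpace G] [Group G] [IsTopologicalGroup G]
    [TopologicalSpace H] [Group H] [IsTopologicalGroup H] (f : G →* H) (hf : Continuous f) :
    G ⧸ Subgroup.connectedComponentOfOne G →* H ⧸ Subgroup.connectedComponentOfOne H :=
  QuotientGroup.map _ _ f (fun x hx => by
    have h := hf.image_connectedComponent_subset (1 : G)
    rw [map_one] at h
    exact h ⟨x, hx, rfl⟩)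

section K1

variable [IsScalarTower ℂ A A] [SMulCommClass ℂ A A] [IsScalarTower ℂ B B] [SMulCommClass ℂ B B]
  [IsScalarTower ℂ C C] [SMulCommClass ℂ C C]

/-- `GL_n⁺(A)`, the group of all `x ∈ GL_n(A⁺)` with `x ≡ 1` modulo `M_n(A)`, with the norm
topology. -/
def GLPlus (A : Type u) [NonUnitalNormedRing A] [NormedSpace ℂ A] [IsScalarTower ℂ A A]
    [SMulCommClass ℂ A A] (n : ℕ) : Subgroup (Matrix (Fin n) (Fin n) (Plus A))ˣ :=
  (Units.map ((Plus.scalar A).mapMatrix : Matrix (Fin n) (Fin n) (Plus A) →+*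
    Matrix (Fin n) (Fin n) ℂ).toMonoidHom).ker

/-- The map `GL_n⁺(A) → GL_m⁺(A)`, `x ↦ diag(x, 1)`, for `n ≤ m`. -/
def GLPlus.stab (A : Type u) [NonUnitalNormedRing A] [NormedSpace ℂ A] [IsScalarTower ℂ A A]
    [SMulCommClass ℂ A A] {n m : ℕ} (h : n ≤ m) : GLPlus A n →* GLPlus A m :=
  ((Units.map (matrixStab (Plus A) h)).comp (GLPlus A n).subtype).codRestrict (GLPlus A m)
    (fun x => by
      rw [GLPlus, MonoidHom.mem_ker]
      have hx : (x.1.1).map (Plus.scalar A) = 1 := congrArg Units.val (MonoidHom.mem_ker.1 x.2)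
      refine Units.ext ?_
      change (matrixStab (Plus A) h x.1.1).map (Plus.scalar A) = 1
      rw [matrixStab_map, hx, map_one])

theorem GLPlus.continuous_stab {n m : ℕ} (h : n ≤ m) : Continuous (GLPlus.stab A h) :=
  (((continuous_matrixStab (Plus A) h).units_map _).comp continuous_subtype_val).subtype_mk _

/-- The map `GL_n⁺(A) → GL_n⁺(B)` given by entrywise application of `φ⁺ : A⁺ → B⁺`. -/
def GLPlus.map (φ : ContrHom A B) (n : ℕ) : GLPlus A n →* GLPlus B n :=
  ((Units.map ((Plus.map φ).mapMatrix : Matrix (Fin n) (Fin n) (Plus A) →+*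
    Matrix (Fin n) (Fin n) (Plus B)).toMonoidHom).comp (GLPlus A n).subtype).codRestrict (GLPlus B n)
    (fun x => by
      rw [GLPlus, MonoidHom.mem_ker]
      have hx : (x.1.1).map (Plus.scalar A) = 1 := congrArg Units.val (MonoidHom.mem_ker.1 x.2)
      refine Units.ext ?_
      change ((x.1.1).map (Plus.map φ)).map (Plus.scalar B) = 1
      rw [Matrix.map_map, ← hx, ← Plus.scalar_comp_map φ]
      rfl)

theorem GLPlus.continuous_map (φ : ContrHom A B) (n : ℕ) : Continuous (GLPlus.map φ n) :=
  (Continuous.comp (Continuous.units_map _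
    (Continuous.matrix_map continuous_id (Plus.continuous_map φ)))
    continuous_subtype_val).subtype_mk _

theorem GLPlus.map_stab (φ : ContrHom A B) {n m : ℕ} (h : n ≤ m) (x : GLPlus A n) :
    GLPlus.stab B h (GLPlus.map φ n x) = GLPlus.map φ m (GLPlus.stab A h x) :=
  Subtype.ext (Units.ext (matrixStab_map (Plus.map φ) h x.1.1).symm)

/-- `GL_n⁺(A) / GL_n⁺(A)₀`, where `GL_n⁺(A)₀` is the connected component of the identity. -/
abbrev GLPi0 (A : Type u) [NonUnitalNormedRing A] [NormedSpace ℂ A] [IsScalarTower ℂ A A]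
    [SMulCommClass ℂ A A] (n : ℕ) : Type u :=
  GLPlus A n ⧸ Subgroup.connectedComponentOfOne (GLPlus A n)

/-- The map `GL_n⁺(A) / GL_n⁺(A)₀ → GL_m⁺(A) / GL_m⁺(A)₀` induced by `x ↦ diag(x, 1)`. -/
def GLPi0.stab (A : Type u) [NonUnitalNormedRing A] [NormedSpace ℂ A] [IsScalarTower ℂ A A]
    [SMulCommClass ℂ A A] (n m : ℕ) (h : n ≤ m) : GLPi0 A n →* GLPi0 A m :=
  pi0Map (GLPlus.stab A h) (GLPlus.continuous_stab h)

def GLPi0.map (φ : ContrHom A B) (n : ℕ) : GLPi0 A n →* GLPi0 B n :=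
  pi0Map (GLPlus.map φ n) (GLPlus.continuous_map φ n)

theorem GLPi0.map_stab (φ : ContrHom A B) (n m : ℕ) (h : n ≤ m) (x : GLPi0 A n) :
    GLPi0.stab B n m h (GLPi0.map φ n x) = GLPi0.map φ m (GLPi0.stab A n m h x) := by
  induction x using QuotientGroup.induction_on with
  | H x => exact congrArg _ (GLPlus.map_stab φ h x)

instance (A : Type u) [NonUnitalNormedRing A] [NormedSpace ℂ A] [IsScalarTower ℂ A A]
    [SMulCommClass ℂ A A] : DirectedSystem (GLPi0 A) (fun n m h => GLPi0.stab A n m h) where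
  map_self n x := by
    induction x using QuotientGroup.induction_on with
    | H x =>
      exact congrArg (QuotientGroup.mk (s := Subgroup.connectedComponentOfOne (GLPlus A n)))
        (Subtype.ext (Units.ext (matrixStab_refl (Plus A) x.1.1)) :
          GLPlus.stab A le_rfl x = x)
  map_map k j i hij hjk x := by
    induction x using QuotientGroup.induction_on with
    | H x =>
      exact congrArg (QuotientGroup.mk (s := Subgroup.connectedComponentOfOne (GLPlus A _)))
        (Subtype.ext (Units.ext (matrixStab_trans (Plus A) hij hjk x.1.1)) :
          GLPlus.stab A hjk (GLPlus.stab A hij x) = GLPlus.stab A (hij.trans hjk) x)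

/-- `K₁(A)`, the direct limit of the groups `GL_n⁺(A) / GL_n⁺(A)₀` along `x ↦ diag(x, 1)`. -/
def K1 (A : Type u) [NonUnitalNormedRing A] [NormedSpace ℂ A] [IsScalarTower ℂ A A]
    [SMulCommClass ℂ A A] : Type u :=
  DirectLimit (GLPi0 A) (GLPi0.stab A)

namespace K1

instance : Group (K1 A) := inferInstanceAs (Group (DirectLimit (GLPi0 A) (GLPi0.stab A)))

/-- The homomorphism `K₁(A) → K₁(B)` induced by `φ`. -/
def map (φ : ContrHom A B) : K1 A →* K1 B where
  toFun := DirectLimit.map (GLPi0.stab A) (GLPi0.stab B) (fun n => GLPi0.map φ n)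
    (GLPi0.map_stab φ)
  map_one' := by
    change DirectLimit.map _ _ _ _ (1 : DirectLimit (GLPi0 A) (GLPi0.stab A)) =
      (1 : DirectLimit (GLPi0 B) (GLPi0.stab B))
    rw [DirectLimit.one_def 0, DirectLimit.one_def 0, DirectLimit.map_def, map_one]
  map_mul' := DirectLimit.induction₂ _ fun n x y => by
    change DirectLimit.map _ _ _ _
        (Quotient.mk _ ⟨n, x⟩ * Quotient.mk _ ⟨n, y⟩ : DirectLimit (GLPi0 A) (GLPi0.stab A)) =
      (Quotient.mk _ ⟨n, GLPi0.map φ n x⟩ * Quotient.mk _ ⟨n, GLPi0.map φ n y⟩ :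
        DirectLimit (GLPi0 B) (GLPi0.stab B))
    rw [DirectLimit.mul_def, DirectLimit.mul_def, DirectLimit.map_def, map_mul]

theorem map_id (x : K1 A) : map (ContrHom.id A) x = x := by
  induction x using DirectLimit.induction with
  | ih n x =>
    induction x using QuotientGroup.induction_on with
    | H x =>
      have h : GLPlus.map (ContrHom.id A) n x = x := by
        refine Subtype.ext (Units.ext ?_)
        change (x.1.1).map (Plus.map (ContrHom.id A)) = x.1.1
        rw [Plus.map_id]
        rfl
      exact congrArg (fun y : GLPlus A n =>
        (Quotient.mk _ ⟨n, (y : GLPi0 A n)⟩ : DirectLimit (GLPi0 A) (GLPi0.stab A))) h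

theorem map_comp (ψ : ContrHom B C) (φ : ContrHom A B) (x : K1 A) :
    map (ψ.comp φ) x = map ψ (map φ x) := by
  induction x using DirectLimit.induction with
  | ih n x =>
    induction x using QuotientGroup.induction_on with
    | H x =>
      have h : GLPlus.map (ψ.comp φ) n x = GLPlus.map ψ n (GLPlus.map φ n x) := by
        refine Subtype.ext (Units.ext ?_)
        change (x.1.1).map (Plus.map (ψ.comp φ)) =
          ((x.1.1).map (Plus.map φ)).map (Plus.map ψ)
        rw [Plus.map_comp]
        rfl
      exact congrArg (fun y : GLPlus C n =>
        (Quotient.mk _ ⟨n, (y : GLPi0 C n)⟩ : DirectLimit (GLPi0 C) (GLPi0.stab C))) h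

end K1

end K1

end Unitization

/-! ### Direct limits of Banach algebras -/

section Limits

variable {I : Type v} [Preorder I] {A : I → Type u} [∀ i, NonUnitalNormedRing (A i)]
  [∀ i, NormedSpace ℂ (A i)]

/-- `L` with the maps `ψ i : A i → L` is a direct limit of the direct system `(A, φ)` in the
category of Banach algebras and contractive homomorphisms. -/
structure IsBanachDirectLimit (φ : ∀ i j, i ≤ j → ContrHom (A i) (A j))
    (L : Type (max u v)) [NonUnitalNormedRing L] [NormedSpace ℂ L]
    (ψ : ∀ i, ContrHom (A i) L) : Prop where
  compat : ∀ i j (h : i ≤ j) (a : A i), ψ j (φ i j h a) = ψ i a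
  existsUnique : ∀ (B : Type (max u v)) [NonUnitalNormedRing B] [NormedSpace ℂ B]
    [IsScalarTower ℂ B B] [SMulCommClass ℂ B B] [CompleteSpace B] (γ : ∀ i, ContrHom (A i) B),
    (∀ i j (h : i ≤ j) (a : A i), γ j (φ i j h a) = γ i a) →
      ∃! g : ContrHom L B, ∀ i (a : A i), g (ψ i a) = γ i a

variable [IsDirectedOrder I] [Nonempty I]
  [∀ i, IsScalarTower ℂ (A i) (A i)] [∀ i, SMulCommClass ℂ (A i) (A i)]
  (φ : ∀ i j, i ≤ j → ContrHom (A i) (A j)) [DirectedSystem A (fun i j h => φ i j h)]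

instance K0.directedSystem :
    DirectedSystem (fun i => K0 (A i)) (fun i j h => K0.map (φ i j h)) where
  map_self i x := by
    have h : φ i i le_rfl = ContrHom.id (A i) :=
      DFunLike.ext _ _ fun a => DirectedSystem.map_self (f := fun i j h => φ i j h) a
    rw [h, K0.map_id]
  map_map k j i hij hjk x := by
    have h : (φ j k hjk).comp (φ i j hij) = φ i k (hij.trans hjk) :=
      DFunLike.ext _ _ fun a => DirectedSystem.map_map (f := fun i j h => φ i j h) hij hjk a
    rw [← h, K0.map_comp]

instance K1.directedSystem :
    DirectedSystem (fun i => K1 (A i)) (fun i j h => K1.map (φ i j h)) where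
  map_self i x := by
    have h : φ i i le_rfl = ContrHom.id (A i) :=
      DFunLike.ext _ _ fun a => DirectedSystem.map_self (f := fun i j h => φ i j h) a
    rw [h, K1.map_id]
  map_map k j i hij hjk x := by
    have h : (φ j k hjk).comp (φ i j hij) = φ i k (hij.trans hjk) :=
      DFunLike.ext _ _ fun a => DirectedSystem.map_map (f := fun i j h => φ i j h) hij hjk a
    rw [← h, K1.map_comp]

variable {L : Type w} [NonUnitalNormedRing L] [NormedSpace ℂ L] [IsScalarTower ℂ L L]
  [SMulCommClass ℂ L L]

/-- The natural homomorphism `lim K₀(A_i) → K₀(L)` for compatible maps `ψ i : A i → L`. -/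
def K0.limMap (ψ : ∀ i, ContrHom (A i) L)
    (hψ : ∀ i j (h : i ≤ j) (a : A i), ψ j (φ i j h a) = ψ i a) :
    DirectLimit (fun i => K0 (A i)) (fun i j h => K0.map (φ i j h)) →+ K0 L where
  toFun := DirectLimit.lift _ (fun i => K0.map (ψ i)) (fun i j h x => by
    have h' : (ψ j).comp (φ i j h) = ψ i := DFunLike.ext _ _ (hψ i j h)
    rw [← h', K0.map_comp])
  map_zero' := DirectLimit.lift_zero (fun i => K0.map (ψ i)) _
  map_add' := DirectLimit.lift_add (fun i => K0.map (ψ i)) _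

/-- The natural homomorphism `lim K₁(A_i) → K₁(L)` for compatible maps `ψ i : A i → L`. -/
def K1.limMap (ψ : ∀ i, ContrHom (A i) L)
    (hψ : ∀ i j (h : i ≤ j) (a : A i), ψ j (φ i j h a) = ψ i a) :
    DirectLimit (fun i => K1 (A i)) (fun i j h => K1.map (φ i j h)) →* K1 L where
  toFun := DirectLimit.lift _ (fun i => K1.map (ψ i)) (fun i j h x => by
    have h' : (ψ j).comp (φ i j h) = ψ i := DFunLike.ext _ _ (hψ i j h)
    rw [← h', K1.map_comp])
  map_one' := DirectLimit.lift_one (fun i => K1.map (ψ i)) _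
  map_mul' := DirectLimit.lift_mul (fun i => K1.map (ψ i)) _

end Limits

/-! ### Spatial `L^p` UHF algebras -/

/-- `M^p_d = L(L^p(Z, λ))` for `Z` a set with `d` points and `λ` normalized counting measure. -/
abbrev MatrixLp (p : ℝ≥0∞) [Fact (1 ≤ p)] (d : ℕ) : Type :=
  MeasureTheory.Lp ℂ p ((d : ℝ≥0∞)⁻¹ • (MeasureTheory.Measure.count : MeasureTheory.Measure (Fin d)))
    →L[ℂ]
  MeasureTheory.Lp ℂ p ((d : ℝ≥0∞)⁻¹ • (MeasureTheory.Measure.count : MeasureTheory.Measure (Fin d)))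

/-- `D` is a spatial `L^p` UHF algebra of type `N`. -/
def IsSpatialUHF (p : ℝ≥0∞) [Fact (1 ≤ p)] (N : Nat.Primes → ℕ∞) (D : Type u) [NormedRing D]
    [NormedAlgebra ℂ D] : Prop :=
  ∃ r : ℕ → ℕ, r 0 = 1 ∧ (∀ n, 0 < r n) ∧ (∀ n, r n ∣ r (n + 1)) ∧
    (∀ t : Nat.Primes, N t = ⨆ (m : ℕ) (_ : ∃ n, (t : ℕ) ^ m ∣ r n), (m : ℕ∞)) ∧
    ∃ S : ℕ → Subalgebra ℂ D, Monotone S ∧ closure (⋃ n, (S n : Set D)) = Set.univ ∧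
      ∀ n, ∃ e : S n ≃ₐ[ℂ] MatrixLp p (r n), ∀ a, ‖e a‖ = ‖a‖

/-- `r(n) = p_1 ^ min(N(p_1), n) ⋯ p_n ^ min(N(p_n), n)`, for the enumeration
`p_{k+1} = enum k` of the primes. -/
def uhfSeq (enum : ℕ ≃ Nat.Primes) (N : Nat.Primes → ℕ∞) (n : ℕ) : ℕ :=
  ∏ k ∈ Finset.range n, (enum k : ℕ) ^ (min (N (enum k)) (n : ℕ∞)).toNat

end

noncomputable section

open Filter Topology

/-! Continuity of K-theory rests on two properties of a limit `L`: the images of the `A i` are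
dense, and an element whose image has norm below `ε` has norm below `ε` at some later stage.
`IsBanachApproxLimit` records them, and they pass to unitizations (`IsBanachApproxLimit.plus`) and
matrices (`IsApproxLimit.matrix`). An explicit limit with these properties is a completion for the
infimum seminorm (`exists_isBanachDirectLimit`); the universal property transfers them to every
other limit.

Invertibility is an open condition visible at a finite stage (`IsApproxLimit.exists_isUnit`). For
`K0`, an idempotent of the limit is approximated by an element `a` with `a² - a` small, which is
corrected to an idempotent at a finite stage and is similar to the given one. Murray-von Neumann
equivalence is rewritten as the invertibility of two polynomial expressions, so it too descends. The
stabilizing class in the Grothendieck group is lifted in the same way. For `K1`, elements near `1`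
lie in the identity component, which gives surjectivity; injectivity follows because the images of
the identity components have an open, hence clopen, closure (`connectedComponentOfOne_le`).

For a UHF algebra the system consists of matrix algebras. Their `K1` vanishes because a complex line
in a finite-dimensional algebra that contains an invertible element has only finitely many singular
points, and the plane minus finitely many points is connected. Their `K0` is `ℤ` by the trace.
Dividing by the size sends `[1]` to `1`, and this normalization forces compatibility along the
system, so the limit is the union of the groups `r(n)⁻¹ℤ`. That union depends only on the
supernatural number of the sequence (`iUnion_inv_mul_eq`). -/

instance GLPlus.isTopologicalGroup (A : Type*) [NonUnitalNormedRing A] [NormedSpace ℂ A]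
    [IsScalarTower ℂ A A] [SMulCommClass ℂ A A] (n : ℕ) : IsTopologicalGroup (GLPlus A n) :=
  inferInstance

theorem mul_inv_mem_nhds {G : Type*} [Group G] [TopologicalSpace G] [IsTopologicalGroup G] (a : G)
    {U : Set G} (hU : U ∈ 𝓝 1) : (fun y => a * y⁻¹) ⁻¹' U ∈ 𝓝 a := by
  have hc : Continuous fun y : G => a * y⁻¹ := by fun_prop
  have ht := hc.tendsto a
  rw [mul_inv_cancel] at ht
  exact ht hU

theorem inv_mul_mem_nhds {G : Type*} [Group G] [TopologicalSpace G] [IsTopologicalGroup G] (a : G)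
    {U : Set G} (hU : U ∈ 𝓝 1) : (fun y => y⁻¹ * a) ⁻¹' U ∈ 𝓝 a := by
  have hc : Continuous fun y : G => y⁻¹ * a := by fun_prop
  have ht := hc.tendsto a
  rw [inv_mul_cancel] at ht
  exact ht hU

/-! ### Normed ring structures on matrix rings -/

/-- The `ℓ^∞` operator norm on square matrices, as a normed ring structure inducing the
product uniformity. -/
@[reducible]
def matrixNormedRing {n : ℕ} {R : Type*} [NormedRing R] : NormedRing (Matrix (Fin n) (Fin n) R) :=
  let i : NormedRing (Matrix (Fin n) (Fin n) R) := Matrix.linftyOpNormedRing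
  { i with
    -- Matrices already carry the product uniformity. Making the two uniformities agree
    -- definitionally lets entrywise continuity and the norm be used together.
    toMetricSpace :=
      { i.toMetricSpace with
        toPseudoMetricSpace :=
          i.toPseudoMetricSpace.replaceUniformity (U := Matrix.instUniformSpace ..) rfl }
    dist_eq := i.dist_eq
    norm_mul_le := i.norm_mul_le }

attribute [local instance] matrixNormedRing

theorem matrixNormedRing_norm_lt_iff {n : ℕ} {R : Type*} [NormedRing R]
    (a : Matrix (Fin n) (Fin n) R) {ε : ℝ} (hε : 0 < ε) :
    ‖a‖ < ε ↔ ∀ r, ∑ s, ‖a r s‖ < ε := by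
  have h : ‖a‖ = ↑(Finset.univ.sup fun i => ∑ j, ‖a i j‖₊) := Matrix.linfty_opNorm_def a
  lift ε to NNReal using hε.le
  rw [h, NNReal.coe_lt_coe, Finset.sup_lt_iff (by simpa using hε)]
  simp [← NNReal.coe_lt_coe]

/-! ### Approximation of a normed ring by a directed system -/

/-- The ring `S` is approximated by the directed system `R i`: the images of the `R i` are dense,
and the norm of the image in `S` is the eventual bound of the norm in the system. -/
structure IsApproxLimit {I : Type*} [Preorder I] {R : I → Type*} [∀ i, NormedRing (R i)]
    {S : Type*} [NormedRing S] (φ : ∀ i j, i ≤ j → R i →+* R j) (ψ : ∀ i, R i →+* S) : Prop where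
  map_map : ∀ i j k (hij : i ≤ j) (hjk : j ≤ k) (a : R i),
    φ j k hjk (φ i j hij a) = φ i k (hij.trans hjk) a
  compat : ∀ i j (h : i ≤ j) (a : R i), ψ j (φ i j h a) = ψ i a
  norm_le : ∀ i (a : R i), ‖ψ i a‖ ≤ ‖a‖
  dense : ∀ y : S, ∀ U ∈ 𝓝 y, ∃ i, ∃ a : R i, ψ i a ∈ U
  norm : ∀ i (a : R i) (ε : ℝ), ‖ψ i a‖ < ε → ∀ᶠ k in atTop, ∀ h : i ≤ k, ‖φ i k h a‖ < ε

/-- `a` has the right inverse `b * c` and the left inverse `d * b`, and these must coincide. An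
approximate inverse found by density makes both products invertible, not `a` itself. -/
theorem isUnit_of_mul_isUnit {M : Type*} [Monoid M] {a b : M} (h : IsUnit (a * b))
    (h' : IsUnit (b * a)) : IsUnit a := by
  obtain ⟨c, hc⟩ := h.exists_right_inv
  obtain ⟨d, hd⟩ := h'.exists_left_inv
  have e : d * b = b * c := by
    calc d * b = d * b * (a * b * c) := by rw [hc, mul_one]
      _ = d * (b * a) * (b * c) := by simp only [mul_assoc]
      _ = b * c := by rw [hd, one_mul]
  refine ⟨⟨a, b * c, by rw [← mul_assoc, hc], by rw [← e, mul_assoc, hd]⟩, rfl⟩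

theorem isUnit_of_norm_sub_one_lt {R : Type*} [NormedRing R] [CompleteSpace R] {a : R}
    (h : ‖a - 1‖ < 1) : IsUnit a := by
  rw [norm_sub_rev] at h
  simpa using isUnit_one_sub_of_norm_lt_one h

namespace IsApproxLimit

variable {I : Type*} [Preorder I] {R : I → Type*}
  [∀ i, NormedRing (R i)] {S : Type*} [NormedRing S] {φ : ∀ i j, i ≤ j → R i →+* R j}
  {ψ : ∀ i, R i →+* S}

theorem isUnit_of_le (H : IsApproxLimit φ ψ) {i k l : I} {a : R i} {hik : i ≤ k}
    (h : IsUnit (φ i k hik a)) (hkl : k ≤ l) : IsUnit (φ i l (hik.trans hkl) a) := by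
  rw [← H.map_map i k l hik hkl]
  exact h.map _

variable [IsDirectedOrder I]

theorem dense_ge (H : IsApproxLimit φ ψ) (i₀ : I) (y : S) {U : Set S} (hU : U ∈ 𝓝 y) :
    ∃ i, i₀ ≤ i ∧ ∃ a : R i, ψ i a ∈ U := by
  obtain ⟨i, a, ha⟩ := H.dense y U hU
  obtain ⟨j, hj, hj'⟩ := exists_ge_ge i i₀
  exact ⟨j, hj', φ i j hj a, by rwa [H.compat]⟩

variable [Nonempty I]

theorem exists_ge_norm_lt (H : IsApproxLimit φ ψ) {i : I} (a : R i) {ε : ℝ} (h : ‖ψ i a‖ < ε) :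
    ∃ k, ∃ h : i ≤ k, ‖φ i k h a‖ < ε := by
  obtain ⟨k, hk, hik⟩ := ((H.norm i a ε h).and (eventually_ge_atTop i)).exists
  exact ⟨k, hik, hk hik⟩

theorem exists_isUnit_of_norm_sub_one_lt [∀ i, CompleteSpace (R i)] (H : IsApproxLimit φ ψ) {i : I}
    (a : R i) (h : ‖ψ i a - 1‖ < 1) : ∃ k, ∃ h : i ≤ k, IsUnit (φ i k h a) := by
  obtain ⟨k, hk, hk'⟩ := H.exists_ge_norm_lt (a - 1) (ε := 1) (by simpa using h)
  exact ⟨k, hk, isUnit_of_norm_sub_one_lt (by simpa using hk')⟩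

/-- Invertibility in the limit ring is already visible at a finite stage. -/
theorem exists_isUnit [∀ i, CompleteSpace (R i)] (H : IsApproxLimit φ ψ) {i : I}
    (a : R i) (h : IsUnit (ψ i a)) : ∃ k, ∃ h : i ≤ k, IsUnit (φ i k h a) := by
  obtain ⟨u, hu⟩ := h
  -- Being an inverse up to an error below `1` on both sides is an open condition, so density
  -- supplies such a `b` at a finite stage.
  have hU : {b : S | ‖ψ i a * b - 1‖ < 1} ∩ {b : S | ‖b * ψ i a - 1‖ < 1} ∈ 𝓝 (↑u⁻¹ : S) := by
    refine IsOpen.mem_nhds (.inter ?_ ?_) (by simp [← hu])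
    · exact isOpen_lt (f := fun b : S => ‖ψ i a * b - 1‖) (by fun_prop) continuous_const
    · exact isOpen_lt (f := fun b : S => ‖b * ψ i a - 1‖) (by fun_prop) continuous_const
  obtain ⟨j, hij, b, hb, hb'⟩ := H.dense_ge i _ hU
  obtain ⟨k, hjk, hk⟩ := H.exists_isUnit_of_norm_sub_one_lt (φ i j hij a * b)
    (by simpa [H.compat] using hb)
  obtain ⟨l, hkl, hl⟩ := H.exists_isUnit_of_norm_sub_one_lt (φ j k hjk (b * φ i j hij a))
    (by simpa [H.compat] using hb')
  refine ⟨l, (hij.trans hjk).trans hkl, isUnit_of_mul_isUnit (b := φ k l hkl (φ j k hjk b)) ?_ ?_⟩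
  · have := hk.map (φ k l hkl)
    rwa [map_mul, map_mul, H.map_map, H.map_map] at this
  · rw [map_mul, map_mul, H.map_map, H.map_map, H.map_map i j l] at hl
    rwa [H.map_map]

/-- Finitely many elements can be approximated simultaneously. -/
theorem dense_pi (H : IsApproxLimit φ ψ) (i₀ : I) {T : Type*} [Finite T] (y : T → S)
    {U : Set (T → S)} (hU : U ∈ 𝓝 y) : ∃ i, i₀ ≤ i ∧ ∃ a : T → R i, (fun t => ψ i (a t)) ∈ U := by
  rw [nhds_pi, Filter.mem_pi'] at hU
  obtain ⟨F, V, hV, hVU⟩ := hU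
  choose i hi a ha using fun t => H.dense_ge i₀ (y t) (hV t)
  obtain ⟨k, hk⟩ := Finite.exists_le i
  obtain ⟨k', hkk', hk'⟩ := exists_ge_ge k i₀
  refine ⟨k', hk', fun t => φ (i t) k' ((hk t).trans hkk') (a t), hVU fun t _ => ?_⟩
  rw [H.compat]
  exact ha t

/-- The matrix norm is a maximum of finitely many row sums, so finitely many entrywise estimates
suffice. -/
theorem matrix (H : IsApproxLimit φ ψ) (n : ℕ) :
    IsApproxLimit (R := fun i => Matrix (Fin n) (Fin n) (R i))
      (fun i j h => (φ i j h).mapMatrix) (fun i => (ψ i).mapMatrix) where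
  map_map i j k hij hjk a := by
    ext r s
    exact H.map_map i j k hij hjk (a r s)
  compat i j h a := by
    ext r s
    exact H.compat i j h (a r s)
  norm_le i a := by
    refine le_of_forall_gt fun ε h => ?_
    have hε : 0 < ε := (norm_nonneg _).trans_lt h
    rw [matrixNormedRing_norm_lt_iff _ hε] at h ⊢
    exact fun r => (Finset.sum_le_sum fun s _ => H.norm_le i (a r s)).trans_lt (h r)
  dense y U hU := by
    have e : Continuous fun b : Fin n × Fin n → S => Matrix.of fun r s => b (r, s) := by
      refine continuous_matrix fun r s => ?_
      exact continuous_apply (r, s)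
    obtain ⟨i, -, a, ha⟩ := H.dense_pi (Classical.arbitrary I) (fun t : Fin n × Fin n => y t.1 t.2)
      (e.continuousAt hU)
    exact ⟨i, Matrix.of fun r s => a (r, s), ha⟩
  norm i a ε h := by
    have hε : 0 < ε := (norm_nonneg _).trans_lt h
    rw [matrixNormedRing_norm_lt_iff _ hε] at h
    -- The strict inequality leaves room for a slack `δ` in each entry of the row, by continuity at
    -- `δ = 0`.
    have h1 : ∀ r, ∃ δ > 0, ∑ s, (‖ψ i (a r s)‖ + δ) < ε := by
      intro r
      have hc : Tendsto (fun δ : ℝ => ∑ s, (‖ψ i (a r s)‖ + δ)) (𝓝[>] 0)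
          (𝓝 (∑ s, (‖ψ i (a r s)‖ + 0))) :=
        tendsto_nhdsWithin_of_tendsto_nhds (Continuous.tendsto (by fun_prop) 0)
      obtain ⟨δ, hδ, hδ'⟩ := ((hc.eventually (gt_mem_nhds (by simpa using h r))).and
        self_mem_nhdsWithin).exists
      exact ⟨δ, hδ', hδ⟩
    choose δ hδ hδ' using h1
    have h2 : ∀ᶠ k in atTop, ∀ r s, ∀ h : i ≤ k, ‖φ i k h (a r s)‖ < ‖ψ i (a r s)‖ + δ r :=
      eventually_all.2 fun r => eventually_all.2 fun s => H.norm i (a r s) _ (by simp [hδ r])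
    filter_upwards [h2] with k hk hik
    rw [matrixNormedRing_norm_lt_iff _ hε]
    exact fun r => (Finset.sum_le_sum fun s _ => (hk r s hik).le).trans_lt (hδ' r)

end IsApproxLimit

/-! ### Idempotents and approximation -/

/-- A small solution of `s + s² = a² - a` commuting with `a`, by contraction. -/
theorem exists_add_mul_self_eq {R : Type*} [NormedRing R] [CompleteSpace R] (a : R)
    (ha : ‖a * a - a‖ ≤ 3 / 16) :
    ∃ s : R, a * s = s * a ∧ s + s * s = a * a - a ∧ ‖s‖ ≤ 1 / 4 ∧ ‖s‖ ≤ 2 * ‖a * a - a‖ := by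
  set b := a * a - a with hb
  have hab : a * b = b * a := by rw [hb]; noncomm_ring
  -- The contraction is `s ↦ b - s²`. On the ball of radius 1/4 it stays inside, as 3/16 + 1/16 =
  -- 1/4, and its Lipschitz constant is 1/4 + 1/4 = 1/2. Intersecting with the closed commutant of
  -- `a` makes the fixed point commute with `a`.
  let K : Set R := {s | ‖s‖ ≤ 1 / 4} ∩ {s | a * s = s * a}
  have hK : IsClosed K :=
    (isClosed_le continuous_norm continuous_const).inter (isClosed_eq (by fun_prop) (by fun_prop))
  have hmul : ∀ s t : R, ‖s * t‖ ≤ ‖s‖ * ‖t‖ := norm_mul_le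
  have hmaps : Set.MapsTo (fun s => b - s * s) K K := by
    rintro s ⟨hs, hs'⟩
    simp only [Set.mem_ofPred_eq] at hs hs'
    refine ⟨?_, ?_⟩
    · have h1 := norm_sub_le b (s * s)
      have h2 := hmul s s
      have h3 := mul_self_le_mul_self (norm_nonneg s) hs
      simp only [Set.mem_ofPred_eq]
      linarith
    · simp only [Set.mem_ofPred_eq, mul_sub, sub_mul, hab]
      rw [← mul_assoc, hs', mul_assoc, hs', mul_assoc]
  have hcontr : ContractingWith (1 / 2) (hmaps.restrict (fun s => b - s * s) K K) := by
    refine ⟨by norm_num, LipschitzWith.of_dist_le_mul ?_⟩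
    rintro ⟨s, hs, hs'⟩ ⟨t, ht, ht'⟩
    simp only [Set.mem_ofPred_eq] at hs ht
    simp only [Subtype.dist_eq, Set.MapsTo.val_restrict_apply, dist_eq_norm]
    have e : b - s * s - (b - t * t) = -(s * (s - t) + (s - t) * t) := by noncomm_ring
    rw [e, norm_neg]
    have h1 := norm_add_le (s * (s - t)) ((s - t) * t)
    have h2 := hmul s (s - t)
    have h3 := hmul (s - t) t
    have h4 := mul_le_mul_of_nonneg_right hs (norm_nonneg (s - t))
    have h5 := mul_le_mul_of_nonneg_left ht (norm_nonneg (s - t))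
    push_cast
    linarith
  obtain ⟨s, ⟨hs, hs'⟩, hfix, -⟩ := ContractingWith.exists_fixedPoint' hK.isComplete hmaps hcontr
    (x := 0) (by simp [K]) (edist_ne_top _ _)
  have hfix' : b - s * s = s := hfix
  refine ⟨s, hs', by nth_rewrite 1 [← hfix']; abel, hs, ?_⟩
  -- From `s = b - s²` and `‖s‖ ≤ 1/4`: `‖s‖ ≤ ‖b‖ + ‖s‖/4`, hence `‖s‖ ≤ (4/3)‖b‖`.
  have h1 := norm_sub_le b (s * s)
  have h2 := hmul s s
  have h3 := mul_le_mul_of_nonneg_right hs (norm_nonneg s)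
  rw [hfix'] at h1
  nlinarith [norm_nonneg s, norm_nonneg b]

/-- The idempotent `(a + s)(1 + 2s)⁻¹` near an approximate idempotent `a`. -/
theorem exists_idempotent_near {R : Type*} [NormedRing R] [CompleteSpace R] (a : R)
    (ha : ‖a * a - a‖ ≤ 3 / 16) :
    ∃ e s w : R, e * e = e ∧ ‖s‖ ≤ 2 * ‖a * a - a‖ ∧ w = 1 + s + s ∧ IsUnit w ∧
      w * e = a + s := by
  obtain ⟨s, hc, hs, hs1, hs2⟩ := exists_add_mul_self_eq a ha
  -- Since `s + s² = a² - a`, one has `(1 + 2s)² = (2a - 1)²`. So `1 + 2s` is a square root near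
  -- `1`, `(2a - 1)(1 + 2s)⁻¹` squares to `1`, and it equals `2e - 1` for `e = (a + s)(1 + 2s)⁻¹`.
  have hw : IsUnit (1 + s + s) := by
    refine isUnit_of_norm_sub_one_lt ?_
    have : 1 + s + s - 1 = s + s := by abel
    rw [this]
    linarith [norm_add_le s s]
  obtain ⟨w, hw⟩ := hw
  have hcw : Commute (a + s) (↑w⁻¹ : R) := by
    refine Commute.units_inv_right ?_
    rw [hw]
    have h1 : Commute a s := hc
    exact ((Commute.one_right _).add_right (h1.add_left (Commute.refl s))).add_right
      (h1.add_left (Commute.refl s))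
  have hsq : (a + s) * (a + s) = (a + s) * w := by
    have h1 : a * a = a + (s + s * s) := by rw [hs]; abel
    have h2 : (a + s) * (a + s) = a * a + a * s + s * a + s * s := by noncomm_ring
    rw [hw, h2, h1, ← hc]
    have h3 : (a + s) * (1 + s + s) = a + s + a * s + a * s + s * s + s * s := by noncomm_ring
    rw [h3]
    abel
  refine ⟨↑w⁻¹ * (a + s), s, w, ?_, hs2, hw, w.isUnit, by rw [Units.mul_inv_cancel_left]⟩
  calc ↑w⁻¹ * (a + s) * (↑w⁻¹ * (a + s)) = ↑w⁻¹ * ((a + s) * ↑w⁻¹) * (a + s) := by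
        simp only [mul_assoc]
    _ = ↑w⁻¹ * ↑w⁻¹ * ((a + s) * (a + s)) := by rw [hcw.eq]; simp only [mul_assoc]
    _ = ↑w⁻¹ * (a + s) := by
        rw [hsq, mul_assoc, ← mul_assoc _ (a + s), ← hcw.eq, mul_assoc (a + s), Units.inv_mul,
          mul_one, hcw.eq]

/-- An idempotent of the limit ring is similar to one coming from a finite stage. -/
theorem IsApproxLimit.exists_idempotent {I : Type*} [Preorder I] [IsDirectedOrder I] [Nonempty I]
    {R : I → Type*} [∀ i, NormedRing (R i)] {S : Type*} [NormedRing S]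
    {φ : ∀ i j, i ≤ j → R i →+* R j} {ψ : ∀ i, R i →+* S} [∀ i, CompleteSpace (R i)]
    [CompleteSpace S] (H : IsApproxLimit φ ψ) (e : S) (he : e * e = e) :
    ∃ i, ∃ e' : R i, e' * e' = e' ∧ ∃ u : Sˣ, ψ i e' * u = u * e := by
  -- For idempotents `f` and `e`, the element `fe + (1 - f)(1 - e)` intertwines them. With `f =
  -- w⁻¹(a + s)` and `w = 1 + 2s`, multiplying it by `w` gives `F (a, s)`, a polynomial expression
  -- equal to `1` at `(e, 0)`.
  let F : S × S → S := fun p => (p.1 + p.2) * e + (1 + p.2 - p.1) * (1 - e)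
  have hF : Continuous F := by fun_prop
  have hF1 : F (e, 0) = 1 := by
    simp only [F, add_zero, he, mul_sub, sub_mul, one_mul, mul_one]
    abel
  have hU : {p | IsUnit (F p)} ∈ 𝓝 (e, (0 : S)) := by
    refine (Units.isOpen.preimage hF).mem_nhds ?_
    simp [hF1]
  obtain ⟨V, hV, W, hW, hVW⟩ := mem_nhds_prod_iff.1 hU
  obtain ⟨δ, hδ, hδW⟩ := Metric.mem_nhds_iff.1 hW
  -- The bound 3/16 permits the correction to an idempotent; δ/4 gives `‖s‖ ≤ 2η ≤ δ/2 < δ`.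
  set η := min (3 / 16) (δ / 4) with hη
  have hη0 : 0 < η := by positivity
  have hV' : V ∩ {a | ‖a * a - a‖ < η} ∈ 𝓝 e := by
    refine inter_mem hV (IsOpen.mem_nhds ?_ (by simpa [he] using hη0))
    exact isOpen_lt (f := fun a : S => ‖a * a - a‖) (by fun_prop) continuous_const
  obtain ⟨i, a, haV, ha⟩ := H.dense e _ hV'
  obtain ⟨j, hij, hj⟩ := H.exists_ge_norm_lt (a * a - a) (ε := η) (by simpa using ha)
  rw [map_sub, map_mul] at hj
  obtain ⟨e', s, w, he', hs, hw, hwu, hwe⟩ := exists_idempotent_near (φ i j hij a)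
    (hj.le.trans (min_le_left _ _))
  have hsW : ψ j s ∈ W := by
    refine hδW (mem_ball_zero_iff.2 ?_)
    have := H.norm_le j s
    have := min_le_right (3 / 16) (δ / 4)
    linarith
  have hu : IsUnit (F (ψ i a, ψ j s)) := hVW ⟨haV, hsW⟩
  have hwe' : ψ j w * ψ j e' = ψ i a + ψ j s := by
    rw [← map_mul, hwe, map_add, H.compat]
  have hw' : ψ j w = 1 + ψ j s + ψ j s := by simp [hw]
  have hFu : F (ψ i a, ψ j s) = ψ j w * (ψ j e' * e + (1 - ψ j e') * (1 - e)) := by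
    have : ψ j w * (ψ j e' * e + (1 - ψ j e') * (1 - e)) =
        (ψ j w * ψ j e') * e + (ψ j w - ψ j w * ψ j e') * (1 - e) := by noncomm_ring
    rw [this, hwe', hw']
    simp only [F]
    congr 2
    abel
  obtain ⟨w', hw''⟩ := hwu.map (ψ j)
  rw [hFu, ← hw'', Units.isUnit_units_mul] at hu
  obtain ⟨u, hu⟩ := hu
  have he'' : ψ j e' * ψ j e' = ψ j e' := by rw [← map_mul, he']
  refine ⟨j, e', he', u, ?_⟩
  rw [hu]
  -- Both sides reduce to `f * e`.
  generalize ψ j e' = f at he''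
  simp only [mul_add, add_mul, mul_sub, sub_mul, mul_one, one_mul, mul_assoc, he]
  simp only [← mul_assoc, he'']
  abel

/-- Put `x' = exf`, `y' = fye`, `u = x'y' + (1 - e)`, `v = y'x' + (1 - f)`. Then `ue = x'y'`, so
`u⁻¹x'` and `y'` multiply to `e`; since `ux' = x'v`, in the other order they give `y'x'v⁻¹ = f`. The
point is that equivalence now follows from two invertibility conditions, which are stable under
perturbing `x` and `y`. -/
theorem exists_eq_mul_of_isUnit {R : Type*} [Ring R] {m n : Type*} [Fintype m] [Fintype n]
    [DecidableEq m] [DecidableEq n] {e : Matrix m m R} {f : Matrix n n R} (he : e * e = e)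
    (hf : f * f = f) (x : Matrix m n R) (y : Matrix n m R)
    (hu : IsUnit ((e * x * f) * (f * y * e) + (1 - e)))
    (hv : IsUnit ((f * y * e) * (e * x * f) + (1 - f))) :
    ∃ (x' : Matrix m n R) (y' : Matrix n m R), e = x' * y' ∧ f = y' * x' := by
  have h1 : e * (e * x * f) = e * x * f := by simp only [← Matrix.mul_assoc, he]
  have h2 : (e * x * f) * f = e * x * f := by simp only [Matrix.mul_assoc, hf]
  have h3 : f * (f * y * e) = f * y * e := by simp only [← Matrix.mul_assoc, hf]
  have h4 : (f * y * e) * e = f * y * e := by simp only [Matrix.mul_assoc, he]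
  generalize e * x * f = x' at *
  generalize f * y * e = y' at *
  obtain ⟨u, hu⟩ := hu
  obtain ⟨v, hv⟩ := hv
  have hue : (u : Matrix m m R) * e = x' * y' := by
    rw [hu, add_mul, sub_mul, he, one_mul, sub_self, add_zero, Matrix.mul_assoc, h4]
  have hvf : (v : Matrix n n R) * f = y' * x' := by
    rw [hv, add_mul, sub_mul, hf, one_mul, sub_self, add_zero, Matrix.mul_assoc, h2]
  have hfv : f * (v : Matrix n n R) = y' * x' := by
    rw [hv, mul_add, mul_sub, hf, mul_one, sub_self, add_zero, ← Matrix.mul_assoc, h3]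
  have hux : (u : Matrix m m R) * x' = x' * (v : Matrix n n R) := by
    rw [hu, hv, Matrix.add_mul, Matrix.mul_add, Matrix.sub_mul, Matrix.mul_sub, h1, h2,
      Matrix.one_mul, Matrix.mul_one, sub_self, add_zero, add_zero, Matrix.mul_assoc]
  have hux' : (↑u⁻¹ : Matrix m m R) * x' = x' * (↑v⁻¹ : Matrix n n R) := by
    calc (↑u⁻¹ : Matrix m m R) * x' = (↑u⁻¹ : Matrix m m R) * (x' * ((v : Matrix n n R) * (↑v⁻¹ : Matrix n n R))) := by simp
      _ = (↑u⁻¹ : Matrix m m R) * ((u : Matrix m m R) * x') * (↑v⁻¹ : Matrix n n R) := by rw [hux]; simp only [Matrix.mul_assoc]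
      _ = x' * (↑v⁻¹ : Matrix n n R) := by
        rw [← Matrix.mul_assoc, Units.inv_mul, Matrix.one_mul]
  refine ⟨(↑u⁻¹ : Matrix m m R) * x', y', ?_, ?_⟩
  · rw [Matrix.mul_assoc, ← hue, Units.inv_mul_cancel_left]
  · rw [hux', ← Matrix.mul_assoc, ← hfv, mul_assoc, Units.mul_inv, mul_one]

/-! ### Continuity of the semigroup of idempotents -/

namespace VMonoid

variable {I : Type*} [Preorder I] [IsDirectedOrder I] [Nonempty I] {R : I → Type*}
  [∀ i, NormedRing (R i)] [∀ i, CompleteSpace (R i)] {S : Type*} [NormedRing S] [CompleteSpace S]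
  {φ : ∀ i j, i ≤ j → R i →+* R j} {ψ : ∀ i, R i →+* S}

theorem exists_map_eq (H : IsApproxLimit φ ψ) (z : VMonoid S) :
    ∃ i, ∃ x : VMonoid (R i), map (ψ i : R i →ₙ+* S) x = z := by
  obtain ⟨e⟩ := z
  obtain ⟨i, e', he', u, hu⟩ := (H.matrix e.size).exists_idempotent e.mat e.idem
  let M := Matrix (Fin e.size) (Fin e.size) S
  refine ⟨i, mk ⟨e.size, e', he'⟩, Quotient.sound
    ⟨(u * e.mat : M), (e.mat * ↑u⁻¹ : M), ?_, ?_⟩⟩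
  · change (ψ i).mapMatrix e' = (u * e.mat : M) * (e.mat * ↑u⁻¹ : M)
    rw [mul_assoc, ← mul_assoc e.mat, e.idem, ← mul_assoc, ← hu, mul_assoc, Units.mul_inv, mul_one]
  · change e.mat = (e.mat * ↑u⁻¹ : M) * (u * e.mat : M)
    rw [mul_assoc, Units.inv_mul_cancel_left, e.idem]

/-- The matrices implementing the equivalence in the limit are approximated at a finite stage. The
invertibility conditions of `exists_eq_mul_of_isUnit` survive the approximation and then hold at a
later stage. -/
theorem exists_map_eq_map (H : IsApproxLimit φ ψ) {i : I} {x y : VMonoid (R i)}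
    (h : map (ψ i : R i →ₙ+* S) x = map (ψ i : R i →ₙ+* S) y) :
    ∃ j, ∃ hij : i ≤ j, map (φ i j hij : R i →ₙ+* R j) x = map (φ i j hij : R i →ₙ+* R j) y := by
  obtain ⟨e⟩ := x
  obtain ⟨f⟩ := y
  obtain ⟨n, e, he⟩ := e
  obtain ⟨m, f, hf⟩ := f
  obtain ⟨x, y, hxy, hyx⟩ := Quotient.exact h
  change Matrix (Fin n) (Fin m) S at x
  change Matrix (Fin m) (Fin n) S at y
  change e.map (ψ i) = x * y at hxy
  change f.map (ψ i) = y * x at hyx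
  -- All entries of both matrices form one finite family, so that `dense_pi` approximates them at a
  -- single stage.
  let T := (Fin n × Fin m) ⊕ (Fin m × Fin n)
  let X : (T → S) → Matrix (Fin n) (Fin m) S := fun t => Matrix.of fun r s => t (.inl (r, s))
  let Y : (T → S) → Matrix (Fin m) (Fin n) S := fun t => Matrix.of fun r s => t (.inr (r, s))
  have hX : Continuous X := continuous_matrix fun r s => continuous_apply (A := fun _ : T => S) _
  have hY : Continuous Y := continuous_matrix fun r s => continuous_apply (A := fun _ : T => S) _
  have he' : e.map (ψ i) * e.map (ψ i) = e.map (ψ i) := by rw [← Matrix.map_mul, he]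
  have hf' : f.map (ψ i) * f.map (ψ i) = f.map (ψ i) := by rw [← Matrix.map_mul, hf]
  set E := e.map (ψ i) with hE
  set F := f.map (ψ i) with hF
  let p : (T → S) → Matrix (Fin n) (Fin n) S := fun t => (E * X t * F) * (F * Y t * E) + (1 - E)
  let q : (T → S) → Matrix (Fin m) (Fin m) S := fun t => (F * Y t * E) * (E * X t * F) + (1 - F)
  have hp : Continuous p := by fun_prop
  have hq : Continuous q := by fun_prop
  -- At the exact equivalence the cut-down products are `E` and `F`, so both expressions equal `1`.
  let t₀ : T → S := Sum.elim (fun r => x r.1 r.2) (fun r => y r.1 r.2)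
  have hp0 : p t₀ = 1 := by
    change (E * x * F) * (F * y * E) + (1 - E) = 1
    have : (E * x * F) * (F * y * E) = E := by
      calc (E * x * F) * (F * y * E) = E * (x * (F * F) * y) * E := by
            simp only [Matrix.mul_assoc]
        _ = E * ((x * y) * (x * y)) * E := by rw [hf', hyx]; simp only [Matrix.mul_assoc]
        _ = E := by rw [← hxy, he', he', he']
    rw [this]
    abel
  have hq0 : q t₀ = 1 := by
    change (F * y * E) * (E * x * F) + (1 - F) = 1
    have : (F * y * E) * (E * x * F) = F := by
      calc (F * y * E) * (E * x * F) = F * (y * (E * E) * x) * F := by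
            simp only [Matrix.mul_assoc]
        _ = F * ((y * x) * (y * x)) * F := by rw [he', hxy]; simp only [Matrix.mul_assoc]
        _ = F := by rw [← hyx, hf', hf', hf']
    rw [this]
    abel
  have hU : {t | IsUnit (p t)} ∩ {t | IsUnit (q t)} ∈ 𝓝 t₀ :=
    inter_mem ((Units.isOpen.preimage hp).mem_nhds (by simp [hp0]))
      ((Units.isOpen.preimage hq).mem_nhds (by simp [hq0]))
  obtain ⟨j, hij, t, htp, htq⟩ := H.dense_pi i t₀ hU
  let X' : Matrix (Fin n) (Fin m) (R j) := Matrix.of fun r s => t (.inl (r, s))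
  let Y' : Matrix (Fin m) (Fin n) (R j) := Matrix.of fun r s => t (.inr (r, s))
  have hEj : (e.map (φ i j hij)).map (ψ j) = E := by
    ext r s
    exact H.compat i j hij (e r s)
  have hFj : (f.map (φ i j hij)).map (ψ j) = F := by
    ext r s
    exact H.compat i j hij (f r s)
  set e₁ := e.map (φ i j hij)
  set f₁ := f.map (φ i j hij)
  obtain ⟨k, hjk, hk⟩ := (H.matrix n).exists_isUnit
    ((e₁ * X' * f₁) * (f₁ * Y' * e₁) + (1 - e₁)) (by
      have : (ψ j).mapMatrix ((e₁ * X' * f₁) * (f₁ * Y' * e₁) + (1 - e₁)) =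
          p fun r => ψ j (t r) := by
        simp only [map_add, map_sub, map_one, RingHom.mapMatrix_apply, Matrix.map_mul, hEj, hFj]
        rfl
      rw [this]
      exact htp)
  obtain ⟨l, hjl, hl⟩ := (H.matrix m).exists_isUnit
    ((f₁ * Y' * e₁) * (e₁ * X' * f₁) + (1 - f₁)) (by
      have : (ψ j).mapMatrix ((f₁ * Y' * e₁) * (e₁ * X' * f₁) + (1 - f₁)) =
          q fun r => ψ j (t r) := by
        simp only [map_add, map_sub, map_one, RingHom.mapMatrix_apply, Matrix.map_mul, hEj, hFj]
        rfl
      rw [this]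
      exact htq)
  obtain ⟨o, hko, hlo⟩ := exists_ge_ge k l
  have hk' := (H.matrix n).isUnit_of_le hk hko
  have hl' := (H.matrix m).isUnit_of_le hl hlo
  simp only [map_add, map_sub, map_one, RingHom.mapMatrix_apply, Matrix.map_mul] at hk' hl'
  have hj : ∀ {α β : ℕ} (a : Matrix (Fin α) (Fin β) (R i)),
      (a.map (φ i j hij)).map (φ j o (hjk.trans hko)) =
        a.map (φ i o (hij.trans (hjk.trans hko))) := by
    intro α β a
    ext r s
    exact H.map_map i j o hij (hjk.trans hko) (a r s)
  rw [hj, hj] at hk' hl'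
  refine ⟨o, hij.trans (hjk.trans hko), Quotient.sound (exists_eq_mul_of_isUnit ?_ ?_ _ _ hk' hl')⟩
  · rw [← Matrix.map_mul, he]
  · rw [← Matrix.map_mul, hf]

end VMonoid

/-! ### Continuity of the Grothendieck group -/

namespace K00

theorem exists_eq_sub {R : Type*} [NonUnitalRing R] (x : K00 R) :
    ∃ a b : VMonoid R, x = Algebra.GrothendieckAddGroup.of a - Algebra.GrothendieckAddGroup.of b := by
  induction x using AddLocalization.induction_on with
  | H y =>
    obtain ⟨a, b, -⟩ := y
    refine ⟨a, b, ?_⟩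
    rw [eq_sub_iff_add_eq]
    simp only [AddLocalization.mk_eq_addMonoidOf_mk']
    exact (AddLocalization.addMonoidOf ⊤).mk'_spec a _

theorem of_eq_of_iff {R : Type*} [NonUnitalRing R] {a b : VMonoid R} :
    (Algebra.GrothendieckAddGroup.of a : K00 R) = Algebra.GrothendieckAddGroup.of b ↔
      ∃ c, c + a = c + b := by
  refine ((AddLocalization.addMonoidOf ⊤).eq_iff_exists).trans ?_
  simp

variable {I : Type*} [Preorder I] {R : I → Type*} [∀ i, NormedRing (R i)] {S : Type*} [NormedRing S]
  {φ : ∀ i j, i ≤ j → R i →+* R j} {ψ : ∀ i, R i →+* S}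

theorem map_map_of_isApproxLimit (H : IsApproxLimit φ ψ) {i j k : I} (hij : i ≤ j) (hjk : j ≤ k)
    (x : K00 (R i)) : map (φ j k hjk : R j →ₙ+* R k) (map (φ i j hij : R i →ₙ+* R j) x) =
      map (φ i k (hij.trans hjk) : R i →ₙ+* R k) x := by
  rw [← AddMonoidHom.comp_apply, ← map_comp]
  congr 2
  ext a
  exact H.map_map i j k hij hjk a

theorem map_compat_of_isApproxLimit (H : IsApproxLimit φ ψ) {i j : I} (hij : i ≤ j)
    (x : K00 (R i)) : map (ψ j : R j →ₙ+* S) (map (φ i j hij : R i →ₙ+* R j) x) =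
      map (ψ i : R i →ₙ+* S) x := by
  rw [← AddMonoidHom.comp_apply, ← map_comp]
  congr 2
  ext a
  exact H.compat i j hij a

variable [IsDirectedOrder I] [Nonempty I] [∀ i, CompleteSpace (R i)] [CompleteSpace S]

theorem exists_map_eq (H : IsApproxLimit φ ψ) (z : K00 S) :
    ∃ i, ∃ x : K00 (R i), map (ψ i : R i →ₙ+* S) x = z := by
  obtain ⟨a, b, rfl⟩ := exists_eq_sub z
  obtain ⟨i, x, rfl⟩ := VMonoid.exists_map_eq H a
  obtain ⟨j, y, rfl⟩ := VMonoid.exists_map_eq H b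
  obtain ⟨k, hik, hjk⟩ := exists_ge_ge i j
  refine ⟨k, map (φ i k hik : R i →ₙ+* R k) (.of x) - map (φ j k hjk : R j →ₙ+* R k) (.of y), ?_⟩
  rw [map_sub, map_compat_of_isApproxLimit H, map_compat_of_isApproxLimit H, map_of, map_of]

theorem exists_map_eq_zero (H : IsApproxLimit φ ψ) {i : I} {x : K00 (R i)}
    (h : map (ψ i : R i →ₙ+* S) x = 0) :
    ∃ j, ∃ hij : i ≤ j, map (φ i j hij : R i →ₙ+* R j) x = 0 := by
  obtain ⟨a, b, rfl⟩ := exists_eq_sub x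
  rw [map_sub, sub_eq_zero, map_of, map_of, of_eq_of_iff] at h
  -- The classes agree in the limit only after adding some `c` defined over `S`; it has to be lifted
  -- to a finite stage before the equality can descend.
  obtain ⟨c, hc⟩ := h
  obtain ⟨j, c', rfl⟩ := VMonoid.exists_map_eq H c
  obtain ⟨k, hik, hjk⟩ := exists_ge_ge i j
  have h1 : ∀ {i j : I} (hij : i ≤ j) (x : VMonoid (R i)), VMonoid.map (ψ i : R i →ₙ+* S) x =
      VMonoid.map (ψ j : R j →ₙ+* S) (VMonoid.map (φ i j hij : R i →ₙ+* R j) x) := by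
    intro i j hij x
    rw [← AddMonoidHom.comp_apply, ← VMonoid.map_comp]
    congr 2
    ext a
    exact (H.compat i j hij a).symm
  rw [h1 hjk, h1 hik, h1 hik, ← map_add, ← map_add] at hc
  obtain ⟨l, hkl, hl⟩ := VMonoid.exists_map_eq_map H hc
  refine ⟨l, hik.trans hkl, ?_⟩
  rw [← map_map_of_isApproxLimit H hik hkl, map_sub, map_of, map_of, map_sub, sub_eq_zero, map_of,
    map_of, of_eq_of_iff]
  rw [map_add, map_add] at hl
  exact ⟨_, hl⟩

end K00

/-! ### Approximation by directed systems of Banach algebras -/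

/-- The Banach algebra `L` is approximated by the directed system `A i`: the images are dense, and
the norm in `L` is the infimum of the norms in the system. -/
structure IsBanachApproxLimit {I : Type*} [Preorder I] {A : I → Type*}
    [∀ i, NonUnitalNormedRing (A i)] [∀ i, NormedSpace ℂ (A i)] {L : Type*} [NonUnitalNormedRing L]
    [NormedSpace ℂ L] (φ : ∀ i j, i ≤ j → ContrHom (A i) (A j)) (ψ : ∀ i, ContrHom (A i) L) :
    Prop where
  map_map : ∀ i j k (hij : i ≤ j) (hjk : j ≤ k) (a : A i),
    φ j k hjk (φ i j hij a) = φ i k (hij.trans hjk) a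
  compat : ∀ i j (h : i ≤ j) (a : A i), ψ j (φ i j h a) = ψ i a
  dense : ∀ y : L, ∀ ε > 0, ∃ i, ∃ a : A i, ‖ψ i a - y‖ < ε
  norm : ∀ i (a : A i) (ε : ℝ), ‖ψ i a‖ < ε → ∃ k, ∃ h : i ≤ k, ‖φ i k h a‖ < ε

namespace Plus

theorem ext_fst_snd {A : Type*} [NonUnitalNormedRing A] [NormedSpace ℂ A] {x y : Plus A} (h : (WithLp.ofLp x).fst = (WithLp.ofLp y).fst)
    (h' : (WithLp.ofLp x).snd = (WithLp.ofLp y).snd) : x = y :=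
  WithLp.ofLp_injective 1 (Unitization.ext h h')

variable {A : Type*} [NonUnitalNormedRing A] [NormedSpace ℂ A] [IsScalarTower ℂ A A]
  [SMulCommClass ℂ A A] {B : Type*} [NonUnitalNormedRing B] [NormedSpace ℂ B]
  [IsScalarTower ℂ B B] [SMulCommClass ℂ B B]

theorem ofLp_map (φ : ContrHom A B) (x : Plus A) :
    WithLp.ofLp (map φ x) = Unitization.inl (WithLp.ofLp x).fst +
      (φ (WithLp.ofLp x).snd : Unitization ℂ B) := rfl

theorem fst_map (φ : ContrHom A B) (x : Plus A) :
    (WithLp.ofLp (map φ x)).fst = (WithLp.ofLp x).fst := by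
  simp [ofLp_map]

theorem snd_map (φ : ContrHom A B) (x : Plus A) :
    (WithLp.ofLp (map φ x)).snd = φ (WithLp.ofLp x).snd := by
  simp [ofLp_map]

theorem fst_sub (x y : Plus A) :
    (WithLp.ofLp (x - y)).fst = (WithLp.ofLp x).fst - (WithLp.ofLp y).fst := rfl

theorem snd_sub (x y : Plus A) :
    (WithLp.ofLp (x - y)).snd = (WithLp.ofLp x).snd - (WithLp.ofLp y).snd := rfl

theorem norm_map_le (φ : ContrHom A B) (x : Plus A) : ‖map φ x‖ ≤ ‖x‖ := by
  rw [WithLp.unitization_norm_def, WithLp.unitization_norm_def, fst_map, snd_map]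
  exact add_le_add_right (φ.norm_apply_le _) _

end Plus

/-! ### Unitizations and continuity of `K0` -/

namespace IsBanachApproxLimit

variable {I : Type*} [Preorder I] {A : I → Type*}
  [∀ i, NonUnitalNormedRing (A i)] [∀ i, NormedSpace ℂ (A i)]
  [∀ i, IsScalarTower ℂ (A i) (A i)] [∀ i, SMulCommClass ℂ (A i) (A i)]
  {L : Type*} [NonUnitalNormedRing L] [NormedSpace ℂ L] [IsScalarTower ℂ L L] [SMulCommClass ℂ L L]
  {φ : ∀ i j, i ≤ j → ContrHom (A i) (A j)} {ψ : ∀ i, ContrHom (A i) L}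

theorem plus (H : IsBanachApproxLimit φ ψ) :
    IsApproxLimit (fun i j h => Plus.map (φ i j h)) (fun i => Plus.map (ψ i)) where
  map_map i j k hij hjk a := by
    refine Plus.ext_fst_snd ?_ ?_
    · simp only [Plus.fst_map]
    · simp only [Plus.snd_map, H.map_map]
  compat i j h a := by
    refine Plus.ext_fst_snd ?_ ?_
    · simp only [Plus.fst_map]
    · simp only [Plus.snd_map, H.compat]
  norm_le i a := Plus.norm_map_le (ψ i) a
  dense y U hU := by
    obtain ⟨ε, hε, hU⟩ := Metric.mem_nhds_iff.1 hU
    obtain ⟨i, a, ha⟩ := H.dense (WithLp.ofLp y).snd ε hε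
    refine ⟨i, WithLp.toLp 1 (Unitization.inl (WithLp.ofLp y).fst + (a : Unitization ℂ (A i))),
      hU ?_⟩
    rw [mem_ball_iff_norm, WithLp.unitization_norm_def]
    simp only [Plus.fst_sub, Plus.snd_sub, Plus.fst_map, Plus.snd_map]
    simpa using ha
  norm i a ε h := by
    rw [WithLp.unitization_norm_def, Plus.fst_map, Plus.snd_map, ← lt_sub_iff_add_lt'] at h
    obtain ⟨k, hik, hk⟩ := H.norm i _ _ h
    -- The system is contractive, so a bound reached at one stage persists. The scalar part never
    -- changes, and only the remaining room `ε - |λ|` is at stake.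
    filter_upwards [eventually_ge_atTop k] with l hkl hil
    rw [WithLp.unitization_norm_def, Plus.fst_map, Plus.snd_map, ← lt_sub_iff_add_lt',
      ← H.map_map i k l hik hkl]
    exact ((φ k l hkl).norm_apply_le _).trans_lt hk

variable [IsDirectedOrder I] [Nonempty I] [∀ i, CompleteSpace (A i)] [CompleteSpace L]

/-- The maps `Plus.map` preserve scalar parts, so any preimage in `K00` of a class in `K0 L` lies in
the kernel that defines `K0 (A i)`. -/
theorem K0_exists_map_eq (H : IsBanachApproxLimit φ ψ) (z : K0 L) :
    ∃ i, ∃ x : K0 (A i), K0.map (ψ i) x = z := by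
  obtain ⟨i, x, hx⟩ := K00.exists_map_eq H.plus z.1
  refine ⟨i, ⟨x, ?_⟩, Subtype.ext hx⟩
  have h : (Plus.scalar L : Plus L →ₙ+* ℂ).comp (Plus.map (ψ i) : Plus (A i) →ₙ+* Plus L) =
      (Plus.scalar (A i) : Plus (A i) →ₙ+* ℂ) :=
    NonUnitalRingHom.ext fun y => DFunLike.congr_fun (Plus.scalar_comp_map (ψ i)) y
  have hz := z.2
  rw [← hx] at hz
  rw [AddMonoidHom.mem_ker, ← h, K00.map_comp]
  exact hz

theorem K0_exists_map_eq_zero (H : IsBanachApproxLimit φ ψ) {i : I} {x : K0 (A i)}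
    (h : K0.map (ψ i) x = 0) : ∃ j, ∃ hij : i ≤ j, K0.map (φ i j hij) x = 0 := by
  obtain ⟨j, hij, hj⟩ := K00.exists_map_eq_zero H.plus (x := x.1) (congrArg Subtype.val h)
  exact ⟨j, hij, Subtype.ext hj⟩

theorem bijective_K0_limMap [DirectedSystem A (fun i j h => φ i j h)]
    (H : IsBanachApproxLimit φ ψ) : Function.Bijective (K0.limMap φ ψ H.compat) := by
  constructor
  · rw [injective_iff_map_eq_zero]
    intro x
    induction x using DirectLimit.induction with
    | ih i x =>
      intro hx
      obtain ⟨j, hij, hj⟩ := H.K0_exists_map_eq_zero (x := x) hx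
      exact (DirectLimit.exists_eq_zero (G := fun i => K0 (A i))
        (f := fun i j h => K0.map (φ i j h)) ⟨i, x⟩).2 ⟨j, hij, hj⟩
  · intro z
    obtain ⟨i, x, hx⟩ := H.K0_exists_map_eq z
    exact ⟨Quotient.mk _ ⟨i, x⟩, hx⟩

end IsBanachApproxLimit

/-! ### The groups `GL_n⁺` -/

namespace GLPlus

variable {A : Type*} [NonUnitalNormedRing A] [NormedSpace ℂ A] [IsScalarTower ℂ A A]
  [SMulCommClass ℂ A A] {B : Type*} [NonUnitalNormedRing B] [NormedSpace ℂ B]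
  [IsScalarTower ℂ B B] [SMulCommClass ℂ B B] {n : ℕ}

/-- The matrix with the same image as `a` under `A⁺ → A` and scalar part `1`. -/
def withScalarOne (a : Matrix (Fin n) (Fin n) (Plus A)) : Matrix (Fin n) (Fin n) (Plus A) :=
  a.map (fun x => Plus.inr A (WithLp.ofLp x).snd) + 1

theorem withScalarOne_map_scalar (a : Matrix (Fin n) (Fin n) (Plus A)) :
    (withScalarOne a).map (Plus.scalar A) = 1 := by
  have h : (a.map fun x => Plus.inr A (WithLp.ofLp x).snd).map (Plus.scalar A) = 0 := by
    ext r s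
    rfl
  change (Plus.scalar A).mapMatrix (withScalarOne a) = 1
  rw [withScalarOne, map_add, map_one, RingHom.mapMatrix_apply, h, zero_add]

theorem withScalarOne_eq_self {a : Matrix (Fin n) (Fin n) (Plus A)}
    (h : a.map (Plus.scalar A) = 1) : withScalarOne a = a := by
  ext r s : 2
  have hrs : Plus.scalar A (a r s) = (1 : Matrix (Fin n) (Fin n) ℂ) r s := by rw [← h]; rfl
  have e : a r s = Plus.inr A (WithLp.ofLp (a r s)).snd + algebraMap ℂ _ (Plus.scalar A (a r s)) := by
    refine Plus.ext_fst_snd ?_ ?_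
    · exact (zero_add _).symm
    · exact (add_zero _).symm
  have e2 : algebraMap ℂ (Plus A) ((1 : Matrix (Fin n) (Fin n) ℂ) r s) =
      (1 : Matrix (Fin n) (Fin n) (Plus A)) r s := by
    by_cases hr : r = s <;> simp [Matrix.one_apply, hr]
  rw [hrs, e2] at e
  exact e.symm

theorem map_withScalarOne (φ : ContrHom A B) (a : Matrix (Fin n) (Fin n) (Plus A)) :
    (withScalarOne a).map (Plus.map φ) = withScalarOne (a.map (Plus.map φ)) := by
  change (Plus.map φ).mapMatrix (withScalarOne a) = _
  rw [withScalarOne, withScalarOne, map_add, map_one]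
  congr 1
  ext r s : 2
  refine Plus.ext_fst_snd ?_ ?_
  · exact Plus.fst_map φ _
  · exact (Plus.snd_map φ _).trans (Plus.snd_map φ (a r s)).symm

theorem continuous_withScalarOne :
    Continuous (withScalarOne : Matrix (Fin n) (Fin n) (Plus A) → _) := by
  have h : Continuous fun x : Plus A => Plus.inr A (WithLp.ofLp x).snd := by
    have : LipschitzWith 1 fun x : Plus A => Plus.inr A (WithLp.ofLp x).snd := by
      refine LipschitzWith.of_dist_le_mul fun x y => ?_
      rw [dist_eq_norm, dist_eq_norm, ← map_sub, ← Plus.snd_sub, WithLp.unitization_norm_def (x - y)]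
      refine (WithLp.unitization_norm_inr _).le.trans ?_
      simp
    exact this.continuous
  exact (continuous_id.matrix_map h).add continuous_const

/-- An invertible matrix with scalar part `1`, as an element of `GL_n⁺`. -/
def ofIsUnit (a : Matrix (Fin n) (Fin n) (Plus A)) (ha : IsUnit a)
    (h : a.map (Plus.scalar A) = 1) : GLPlus A n :=
  ⟨ha.unit, MonoidHom.mem_ker.2 (Units.ext h)⟩

theorem map_scalar (x : GLPlus A n) : (x.1.1).map (Plus.scalar A) = 1 :=
  congrArg Units.val (MonoidHom.mem_ker.1 x.2)

theorem ext_val {x y : GLPlus A n} (h : x.1.1 = y.1.1) : x = y :=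
  Subtype.ext (Units.ext h)

/-- In a complete normed ring the unit group has the subspace topology, so continuity into `GLPlus`
need not be checked on inverses. -/
theorem isEmbedding_val [CompleteSpace A] :
    IsEmbedding fun x : GLPlus A n => (x.1.1 : Matrix (Fin n) (Fin n) (Plus A)) :=
  Units.isOpenEmbedding_val.isEmbedding.comp IsEmbedding.subtypeVal

/-- The points `1 + z(x - 1)` of the complex line through `1` and `x` all have scalar part `1`. A
parameter set in `ℂ`, rather than a real segment, leaves room to go around singular points. -/
theorem mem_connectedComponentOfOne_of_isPreconnected [CompleteSpace A] {x : GLPlus A n} {Z : Set ℂ}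
    (hZ : IsPreconnected Z) (h0 : 0 ∈ Z) (h1 : 1 ∈ Z)
    (h : ∀ z ∈ Z, IsUnit (1 + z • (x.1.1 - 1))) :
    x ∈ Subgroup.connectedComponentOfOne (GLPlus A n) := by
  have hs : ∀ z : ℂ, (1 + z • (x.1.1 - 1)).map (Plus.scalar A) = 1 := by
    intro z
    have e : (z • (x.1.1 - 1)).map (Plus.scalar A) = z • (x.1.1 - 1).map (Plus.scalar A) := by
      ext r s
      rfl
    change (Plus.scalar A).mapMatrix (1 + z • (x.1.1 - 1)) = 1
    rw [map_add, map_one, RingHom.mapMatrix_apply, e, ← RingHom.mapMatrix_apply, map_sub, map_one,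
      RingHom.mapMatrix_apply, map_scalar, sub_self, smul_zero, add_zero]
  let γ : Z → GLPlus A n := fun z => ofIsUnit _ (h z.1 z.2) (hs z.1)
  have hγ : Continuous γ := by
    rw [isEmbedding_val.continuous_iff]
    exact continuous_const.add (continuous_subtype_val.smul continuous_const)
  have : PreconnectedSpace Z := Subtype.preconnectedSpace hZ
  refine (isPreconnected_range hγ).subset_connectedComponent ⟨⟨0, h0⟩, ?_⟩ ⟨⟨1, h1⟩, ?_⟩
  · exact ext_val (by change 1 + (0 : ℂ) • (x.1.1 - 1) = 1; simp)
  · exact ext_val (by change 1 + (1 : ℂ) • (x.1.1 - 1) = _; simp)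

theorem mem_connectedComponentOfOne_of_norm_lt [CompleteSpace A] {x : GLPlus A n}
    (hx : ‖x.1.1 - 1‖ < 1) : x ∈ Subgroup.connectedComponentOfOne (GLPlus A n) := by
  refine mem_connectedComponentOfOne_of_isPreconnected
    -- For `|z| ≤ 1` the point `1 + z(x - 1)` stays within distance less than `1` of the identity.
    (convex_closedBall (0 : ℂ) 1).isPreconnected (by simp) (by simp) fun z hz => ?_
  refine isUnit_of_norm_sub_one_lt ?_
  rw [add_sub_cancel_left, matrixNormedRing_norm_lt_iff _ one_pos]
  rw [matrixNormedRing_norm_lt_iff _ one_pos] at hx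
  refine fun r => (Finset.sum_le_sum fun s _ => ?_).trans_lt (hx r)
  rw [Matrix.smul_apply, norm_smul]
  exact mul_le_of_le_one_left (norm_nonneg _) (by simpa using hz)

theorem map_mem_connectedComponentOfOne (φ : ContrHom A B) {x : GLPlus A n}
    (hx : x ∈ Subgroup.connectedComponentOfOne (GLPlus A n)) :
    map φ n x ∈ Subgroup.connectedComponentOfOne (GLPlus B n) := by
  have h := (continuous_map φ n).image_connectedComponent_subset 1
  rw [map_one] at h
  exact h ⟨x, hx, rfl⟩

theorem norm_sub_one_lt_mem_nhds [CompleteSpace A] :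
    {y : GLPlus A n | ‖y.1.1 - 1‖ < 1} ∈ 𝓝 1 := by
  have h : Continuous fun y : GLPlus A n => ‖y.1.1 - 1‖ :=
    (isEmbedding_val.continuous.sub continuous_const).norm
  refine (isOpen_lt h continuous_const).mem_nhds ?_
  simp

end GLPlus

/-! ### Density and identity components in the limit -/

namespace IsBanachApproxLimit

variable {I : Type*} [Preorder I] [IsDirectedOrder I] [Nonempty I] {A : I → Type*}
  [∀ i, NonUnitalNormedRing (A i)] [∀ i, NormedSpace ℂ (A i)]
  [∀ i, IsScalarTower ℂ (A i) (A i)] [∀ i, SMulCommClass ℂ (A i) (A i)]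
  {L : Type*} [NonUnitalNormedRing L] [NormedSpace ℂ L] [IsScalarTower ℂ L L] [SMulCommClass ℂ L L]
  {φ : ∀ i j, i ≤ j → ContrHom (A i) (A j)} {ψ : ∀ i, ContrHom (A i) L} {n : ℕ}

theorem GLPlus_map_map (H : IsBanachApproxLimit φ ψ) {i j k : I} (hij : i ≤ j) (hjk : j ≤ k)
    (x : GLPlus (A i) n) : GLPlus.map (φ j k hjk) n (GLPlus.map (φ i j hij) n x) =
      GLPlus.map (φ i k (hij.trans hjk)) n x :=
  GLPlus.ext_val ((H.plus.matrix n).map_map i j k hij hjk x.1.1)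

theorem GLPlus_compat (H : IsBanachApproxLimit φ ψ) {i j : I} (hij : i ≤ j)
    (x : GLPlus (A i) n) : GLPlus.map (ψ j) n (GLPlus.map (φ i j hij) n x) =
      GLPlus.map (ψ i) n x :=
  GLPlus.ext_val ((H.plus.matrix n).compat i j hij x.1.1)

variable [∀ i, CompleteSpace (A i)]

/-- An element whose image is near `1` is eventually in the identity component. -/
theorem GLPlus_exists_mem_of_norm_lt (H : IsBanachApproxLimit φ ψ) {i : I} (x : GLPlus (A i) n)
    (hx : ‖(GLPlus.map (ψ i) n x).1.1 - 1‖ < 1) : ∃ j, ∃ hij : i ≤ j,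
      GLPlus.map (φ i j hij) n x ∈ Subgroup.connectedComponentOfOne (GLPlus (A j) n) := by
  obtain ⟨j, hij, hj⟩ := (H.plus.matrix n).exists_ge_norm_lt (x.1.1 - 1) (ε := 1) (by
    rw [map_sub, map_one]
    exact hx)
  rw [map_sub, map_one] at hj
  exact ⟨j, hij, GLPlus.mem_connectedComponentOfOne_of_norm_lt hj⟩

variable [CompleteSpace L]

/-- The images of the groups `GL_n⁺(A i)` are dense in `GL_n⁺(L)`. -/
theorem GLPlus_exists_map_mem (H : IsBanachApproxLimit φ ψ) (y : GLPlus L n) {U : Set (GLPlus L n)}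
    (hU : U ∈ 𝓝 y) : ∃ i, ∃ x : GLPlus (A i) n, GLPlus.map (ψ i) n x ∈ U := by
  rw [GLPlus.isEmbedding_val.nhds_eq_comap] at hU
  obtain ⟨V, hV, hVU⟩ := hU
  -- A matrix approximating `y` need not have scalar part `1`. The retraction `withScalarOne`
  -- repairs this: it is continuous, fixes `y` and commutes with the maps of the system.
  have hy : GLPlus.withScalarOne y.1.1 = y.1.1 :=
    GLPlus.withScalarOne_eq_self (GLPlus.map_scalar y)
  have hW : {a : Matrix (Fin n) (Fin n) (Plus L) | GLPlus.withScalarOne a ∈ V} ∩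
      {a | IsUnit (GLPlus.withScalarOne a)} ∈ 𝓝 y.1.1 := by
    refine inter_mem ?_ ?_
    · refine GLPlus.continuous_withScalarOne.continuousAt ?_
      rwa [hy]
    · refine ((Units.isOpen (R := Matrix (Fin n) (Fin n) (Plus L))).preimage GLPlus.continuous_withScalarOne).mem_nhds ?_
      simp only [Set.mem_preimage, hy]
      exact y.1.isUnit
  obtain ⟨i, a, haV, hau⟩ := (H.plus.matrix n).dense _ _ hW
  have ha : GLPlus.withScalarOne ((Plus.map (ψ i)).mapMatrix a) =
      (Plus.map (ψ i)).mapMatrix (GLPlus.withScalarOne a) :=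
    (GLPlus.map_withScalarOne (ψ i) a).symm
  obtain ⟨k, hik, hk⟩ := (H.plus.matrix n).exists_isUnit (GLPlus.withScalarOne a) (ha ▸ hau)
  refine ⟨k, GLPlus.ofIsUnit _ hk ?_, hVU ?_⟩
  · have := GLPlus.withScalarOne_map_scalar (a.map (Plus.map (φ i k hik)))
    rwa [← GLPlus.map_withScalarOne] at this
  · have h := (H.plus.matrix n).compat i k hik (GLPlus.withScalarOne a)
    rw [← ha] at h
    change (Plus.map (ψ k)).mapMatrix ((Plus.map (φ i k hik)).mapMatrix _) ∈ V
    rw [h]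
    exact haV

/-- The subgroup of `GL_n⁺(L)` of images of elements of the identity components. -/
def imageComponents (H : IsBanachApproxLimit φ ψ) (n : ℕ) : Subgroup (GLPlus L n) where
  carrier := {y | ∃ i, ∃ x ∈ Subgroup.connectedComponentOfOne (GLPlus (A i) n),
    GLPlus.map (ψ i) n x = y}
  one_mem' := ⟨Classical.arbitrary I, 1, one_mem _, map_one _⟩
  mul_mem' := by
    rintro _ _ ⟨i, x, hx, rfl⟩ ⟨j, y, hy, rfl⟩
    obtain ⟨k, hik, hjk⟩ := exists_ge_ge i j
    refine ⟨k, _, mul_mem (GLPlus.map_mem_connectedComponentOfOne (φ i k hik) hx)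
      (GLPlus.map_mem_connectedComponentOfOne (φ j k hjk) hy), ?_⟩
    rw [map_mul, H.GLPlus_compat, H.GLPlus_compat]
  inv_mem' := by
    rintro _ ⟨i, x, hx, rfl⟩
    exact ⟨i, x⁻¹, inv_mem hx, map_inv _ _⟩

/-- Near `1`, every element is a limit of images of elements near `1`, and these enter the identity
components at later stages. So the closed subgroup is a neighbourhood of `1`, hence clopen, and
contains the component of `1`. -/
theorem connectedComponentOfOne_le (H : IsBanachApproxLimit φ ψ) (n : ℕ) :
    Subgroup.connectedComponentOfOne (GLPlus L n) ≤ (H.imageComponents n).topologicalClosure := by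
  set K := (H.imageComponents n).topologicalClosure
  have hK : (K : Set (GLPlus L n)) ∈ 𝓝 1 := by
    obtain ⟨U, hU, hUo, hU1⟩ := mem_nhds_iff.1 (GLPlus.norm_sub_one_lt_mem_nhds (A := L) (n := n))
    refine mem_of_superset (hUo.mem_nhds hU1) fun y hy => ?_
    refine mem_closure_iff_nhds.2 fun V hV => ?_
    obtain ⟨i, x, hxV, hxU⟩ := H.GLPlus_exists_map_mem y (inter_mem hV (hUo.mem_nhds hy))
    obtain ⟨j, hij, hj⟩ := H.GLPlus_exists_mem_of_norm_lt x (hU hxU)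
    exact ⟨_, hxV, j, _, hj, H.GLPlus_compat hij x⟩
  have hKo := K.isOpen_of_mem_nhds hK
  exact IsClopen.connectedComponent_subset ⟨K.isClosed_of_isOpen hKo, hKo⟩ K.one_mem

/-- Some `z` in an identity component has an image close to that of `x`. Then `x * z⁻¹` has image
near `1`, so it enters the identity component at a later stage, and multiplying by `z` recovers `x`.
-/
theorem GLPlus_exists_mem (H : IsBanachApproxLimit φ ψ) {i : I} (x : GLPlus (A i) n)
    (hx : GLPlus.map (ψ i) n x ∈ Subgroup.connectedComponentOfOne (GLPlus L n)) :
    ∃ j, ∃ hij : i ≤ j,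
      GLPlus.map (φ i j hij) n x ∈ Subgroup.connectedComponentOfOne (GLPlus (A j) n) := by
  have hU : (fun y => GLPlus.map (ψ i) n x * y⁻¹) ⁻¹' {y : GLPlus L n | ‖y.1.1 - 1‖ < 1} ∈
      𝓝 (GLPlus.map (ψ i) n x) := mul_inv_mem_nhds _ GLPlus.norm_sub_one_lt_mem_nhds
  obtain ⟨_, hy, j, z, hz, rfl⟩ := mem_closure_iff_nhds.1 (H.connectedComponentOfOne_le n hx) _ hU
  rw [Set.mem_preimage, Set.mem_ofPred_eq] at hy
  obtain ⟨k, hik, hjk⟩ := exists_ge_ge i j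
  obtain ⟨l, hkl, hl⟩ := H.GLPlus_exists_mem_of_norm_lt
    (GLPlus.map (φ i k hik) n x * (GLPlus.map (φ j k hjk) n z)⁻¹) (by
      rw [map_mul, map_inv, H.GLPlus_compat, H.GLPlus_compat]
      exact hy)
  refine ⟨l, hik.trans hkl, ?_⟩
  rw [map_mul, map_inv, H.GLPlus_map_map, H.GLPlus_map_map] at hl
  have := mul_mem hl (GLPlus.map_mem_connectedComponentOfOne (φ j l (hjk.trans hkl)) hz)
  rwa [inv_mul_cancel_right] at this

end IsBanachApproxLimit

/-! ### The group `K₁` -/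

namespace K1

variable {A : Type*} [NonUnitalNormedRing A] [NormedSpace ℂ A] [IsScalarTower ℂ A A]
  [SMulCommClass ℂ A A] {B : Type*} [NonUnitalNormedRing B] [NormedSpace ℂ B]
  [IsScalarTower ℂ B B] [SMulCommClass ℂ B B] {n : ℕ}

/-- The class in `K₁(A)` of an element of `GL_n⁺(A)`. -/
def mk (x : GLPlus A n) : K1 A :=
  (Quotient.mk _ ⟨n, (x : GLPi0 A n)⟩ : DirectLimit (GLPi0 A) (GLPi0.stab A))

theorem exists_mk_eq (z : K1 A) : ∃ n, ∃ x : GLPlus A n, mk x = z := by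
  induction z using DirectLimit.induction with
  | ih n x =>
    induction x using QuotientGroup.induction_on with
    | H x => exact ⟨n, x, rfl⟩

theorem map_mk (φ : ContrHom A B) (x : GLPlus A n) : map φ (mk x) = mk (GLPlus.map φ n x) := rfl

theorem mk_eq_mk {x y : GLPlus A n} (h : x⁻¹ * y ∈ Subgroup.connectedComponentOfOne (GLPlus A n)) :
    mk x = mk y :=
  congrArg (fun z : GLPi0 A n => (Quotient.mk _ ⟨n, z⟩ : DirectLimit (GLPi0 A) (GLPi0.stab A)))
    (QuotientGroup.eq.2 h)

theorem mk_eq_one_iff (x : GLPlus A n) : mk x = 1 ↔ ∃ m, ∃ h : n ≤ m,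
    GLPlus.stab A h x ∈ Subgroup.connectedComponentOfOne (GLPlus A m) := by
  refine (DirectLimit.exists_eq_one (G := GLPi0 A) (f := GLPi0.stab A) ⟨n, x⟩).trans ?_
  refine exists_congr fun m => exists_congr fun h => ?_
  exact QuotientGroup.eq_one_iff _

end K1

/-! ### Continuity of `K1` -/

namespace IsBanachApproxLimit

variable {I : Type*} [Preorder I] [IsDirectedOrder I] [Nonempty I] {A : I → Type*}
  [∀ i, NonUnitalNormedRing (A i)] [∀ i, NormedSpace ℂ (A i)]
  [∀ i, IsScalarTower ℂ (A i) (A i)] [∀ i, SMulCommClass ℂ (A i) (A i)]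
  {L : Type*} [NonUnitalNormedRing L] [NormedSpace ℂ L] [IsScalarTower ℂ L L] [SMulCommClass ℂ L L]
  {φ : ∀ i j, i ≤ j → ContrHom (A i) (A j)} {ψ : ∀ i, ContrHom (A i) L}
  [∀ i, CompleteSpace (A i)] [CompleteSpace L]

theorem K1_exists_map_eq (H : IsBanachApproxLimit φ ψ) (z : K1 L) :
    ∃ i, ∃ x : K1 (A i), K1.map (ψ i) x = z := by
  obtain ⟨n, y, rfl⟩ := K1.exists_mk_eq z
  have hU : (fun w => w⁻¹ * y) ⁻¹' {w : GLPlus L n | ‖w.1.1 - 1‖ < 1} ∈ 𝓝 y :=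
    inv_mul_mem_nhds _ GLPlus.norm_sub_one_lt_mem_nhds
  obtain ⟨i, x, hx⟩ := H.GLPlus_exists_map_mem y hU
  rw [Set.mem_preimage, Set.mem_ofPred_eq] at hx
  exact ⟨i, K1.mk x, K1.mk_eq_mk (GLPlus.mem_connectedComponentOfOne_of_norm_lt hx)⟩

theorem K1_exists_map_eq_one (H : IsBanachApproxLimit φ ψ) {i : I} {x : K1 (A i)}
    (h : K1.map (ψ i) x = 1) : ∃ j, ∃ hij : i ≤ j, K1.map (φ i j hij) x = 1 := by
  obtain ⟨n, x, rfl⟩ := K1.exists_mk_eq x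
  rw [K1.map_mk, K1.mk_eq_one_iff] at h
  obtain ⟨m, hnm, hm⟩ := h
  rw [GLPlus.map_stab] at hm
  obtain ⟨j, hij, hj⟩ := H.GLPlus_exists_mem _ hm
  refine ⟨j, hij, ?_⟩
  rw [K1.map_mk, K1.mk_eq_one_iff]
  exact ⟨m, hnm, by rwa [GLPlus.map_stab]⟩

theorem bijective_K1_limMap [DirectedSystem A (fun i j h => φ i j h)]
    (H : IsBanachApproxLimit φ ψ) : Function.Bijective (K1.limMap φ ψ H.compat) := by
  constructor
  · rw [injective_iff_map_eq_one]
    intro x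
    induction x using DirectLimit.induction with
    | ih i x =>
      intro hx
      obtain ⟨j, hij, hj⟩ := H.K1_exists_map_eq_one (x := x) hx
      exact (DirectLimit.exists_eq_one (G := fun i => K1 (A i))
        (f := fun i j h => K1.map (φ i j h)) ⟨i, x⟩).2 ⟨j, hij, hj⟩
  · intro z
    obtain ⟨i, x, hx⟩ := H.K1_exists_map_eq z
    exact ⟨Quotient.mk _ ⟨i, x⟩, hx⟩

end IsBanachApproxLimit

/-! ### Direct limits of unital Banach algebras -/

namespace DirectLimit

variable {I : Type v} [Preorder I] [IsDirectedOrder I] {R : I → Type u}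
  [∀ i, NormedRing (R i)] [∀ i, NormedAlgebra ℂ (R i)] (f : ∀ i j, i ≤ j → R i →ₐ[ℂ] R j)
  [DirectedSystem R (fun i j h => f i j h)]

/-- The infimum of the norms of the representatives. -/
def infNorm (x : DirectLimit R f) : ℝ :=
  ⨅ p : {p : Σ i, R i // (Quotient.mk _ p : DirectLimit R f) = x}, ‖p.1.2‖

theorem infNorm_mk_le {i : I} (a : R i) :
    infNorm f (Quotient.mk _ ⟨i, a⟩ : DirectLimit R f) ≤ ‖a‖ := by
  refine ciInf_le (f := fun p : {p : Σ i, R i // (Quotient.mk _ p : DirectLimit R f) =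
    Quotient.mk _ ⟨i, a⟩} => ‖p.1.2‖) ⟨0, ?_⟩ ⟨⟨i, a⟩, rfl⟩
  rintro _ ⟨p, rfl⟩
  exact norm_nonneg _

theorem infNorm_nonneg (x : DirectLimit R f) : 0 ≤ infNorm f x :=
  Real.iInf_nonneg fun _ => norm_nonneg _

variable {f}

theorem exists_norm_lt_of_infNorm_lt {x : DirectLimit R f} {ε : ℝ} (h : infNorm f x < ε) :
    ∃ i, ∃ a : R i, (Quotient.mk _ ⟨i, a⟩ : DirectLimit R f) = x ∧ ‖a‖ < ε := by
  have : Nonempty {p : Σ i, R i // (Quotient.mk _ p : DirectLimit R f) = x} := by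
    obtain ⟨p, hp⟩ := Quotient.exists_rep x
    exact ⟨p, hp⟩
  obtain ⟨⟨⟨i, a⟩, hp⟩, hlt⟩ := exists_lt_of_ciInf_lt h
  exact ⟨i, a, hp, hlt⟩

theorem exists_norm_lt_of_infNorm_lt₂ (hf : ∀ i j h a, ‖f i j h a‖ ≤ ‖a‖) {x y : DirectLimit R f}
    {ε δ : ℝ} (hx : infNorm f x < ε) (hy : infNorm f y < δ) :
    ∃ i, ∃ a b : R i, (Quotient.mk _ ⟨i, a⟩ : DirectLimit R f) = x ∧ ‖a‖ < ε ∧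
      (Quotient.mk _ ⟨i, b⟩ : DirectLimit R f) = y ∧ ‖b‖ < δ := by
  obtain ⟨i, a, ha, ha'⟩ := exists_norm_lt_of_infNorm_lt hx
  obtain ⟨j, b, hb, hb'⟩ := exists_norm_lt_of_infNorm_lt hy
  obtain ⟨k, hik, hjk⟩ := exists_ge_ge i j
  refine ⟨k, f i k hik a, f j k hjk b, ?_, (hf _ _ _ _).trans_lt ha', ?_, (hf _ _ _ _).trans_lt hb'⟩
  · rw [← ha]
    exact (DirectLimit.eq_of_le (f := f) ⟨i, a⟩ k hik).symm
  · rw [← hb]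
    exact (DirectLimit.eq_of_le (f := f) ⟨j, b⟩ k hjk).symm

variable [Nonempty I]

variable (f) in
/-- The seminorm of the algebraic direct limit. -/
def ringSeminorm (hf : ∀ i j h a, ‖f i j h a‖ ≤ ‖a‖) : RingSeminorm (DirectLimit R f) where
  toFun := infNorm f
  map_zero' := by
    refine le_antisymm ?_ (infNorm_nonneg f _)
    have := infNorm_mk_le f (0 : R (Classical.arbitrary I))
    rwa [norm_zero, ← DirectLimit.zero_def] at this
  add_le' x y := by
    refine le_of_forall_pos_lt_add fun ε hε => ?_
    obtain ⟨i, a, b, rfl, ha, rfl, hb⟩ := exists_norm_lt_of_infNorm_lt₂ hf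
      (lt_add_of_pos_right (infNorm f x) (half_pos hε))
      (lt_add_of_pos_right (infNorm f y) (half_pos hε))
    rw [DirectLimit.add_def]
    linarith [infNorm_mk_le f (a + b), norm_add_le a b]
  neg' x := by
    have h : ∀ x : DirectLimit R f, infNorm f (-x) ≤ infNorm f x := by
      intro x
      refine le_of_forall_gt fun ε hε => ?_
      obtain ⟨i, a, rfl, ha⟩ := exists_norm_lt_of_infNorm_lt hε
      rw [DirectLimit.neg_def]
      exact (infNorm_mk_le f (-a)).trans_lt (by rwa [norm_neg])
    refine le_antisymm (h x) ?_
    simpa using h (-x)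
  mul_le' x y := by
    have hlim : Tendsto (fun ε : ℝ => (infNorm f x + ε) * (infNorm f y + ε)) (𝓝[>] 0)
        (𝓝 ((infNorm f x + 0) * (infNorm f y + 0))) :=
      tendsto_nhdsWithin_of_tendsto_nhds (Continuous.tendsto (by fun_prop) 0)
    rw [add_zero, add_zero] at hlim
    refine ge_of_tendsto hlim ?_
    filter_upwards [self_mem_nhdsWithin] with ε hε
    obtain ⟨i, a, b, hx, ha, hy, hb⟩ := exists_norm_lt_of_infNorm_lt₂ hf
      (lt_add_of_pos_right (infNorm f x) hε) (lt_add_of_pos_right (infNorm f y) hε)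
    have : infNorm f (x * y) ≤ ‖a * b‖ := by
      rw [← hx, ← hy, DirectLimit.mul_def]
      exact infNorm_mk_le f (a * b)
    refine this.trans ((norm_mul_le a b).trans ?_)
    exact mul_le_mul ha.le hb.le (norm_nonneg _) ((norm_nonneg _).trans ha.le)

/-- The completed direct limit of a contractive directed system of unital Banach algebras. -/
theorem exists_completion (hf : ∀ i j h a, ‖f i j h a‖ ≤ ‖a‖) :
    ∃ (E : Type (max u v)) (_ : NormedRing E) (_ : NormedAlgebra ℂ E) (_ : CompleteSpace E)
      (ι : ∀ i, R i →ₐ[ℂ] E), (∀ i a, ‖ι i a‖ ≤ ‖a‖) ∧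
      (∀ i j (h : i ≤ j) a, ι j (f i j h a) = ι i a) ∧
      (∀ i (a : R i) (ε : ℝ), ‖ι i a‖ < ε → ∃ k, ∃ h : i ≤ k, ‖f i k h a‖ < ε) ∧
      ∀ (B : Type (max u v)) [NormedRing B] [NormedAlgebra ℂ B] [CompleteSpace B]
        (γ : ∀ i, R i →ₐ[ℂ] B), (∀ i a, ‖γ i a‖ ≤ ‖a‖) →
        (∀ i j (h : i ≤ j) a, γ j (f i j h a) = γ i a) →
        ∃ g : E →ₐ[ℂ] B, (∀ x, ‖g x‖ ≤ ‖x‖) ∧ ∀ i a, g (ι i a) = γ i a := by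
  -- The infimum is only a seminorm; the Hausdorff completion divides out its kernel.
  let : SeminormedRing (DirectLimit R f) := (ringSeminorm f hf).toSeminormedRing
  let : NormedAlgebra ℂ (DirectLimit R f) :=
    { (inferInstance : Algebra ℂ (DirectLimit R f)) with
      norm_smul_le := by
        intro c x
        have hlim : Tendsto (fun ε : ℝ => ‖c‖ * (infNorm f x + ε)) (𝓝[>] 0)
            (𝓝 (‖c‖ * (infNorm f x + 0))) :=
          tendsto_nhdsWithin_of_tendsto_nhds (Continuous.tendsto (by fun_prop) 0)
        rw [add_zero] at hlim
        refine ge_of_tendsto hlim ?_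
        filter_upwards [self_mem_nhdsWithin] with ε hε
        obtain ⟨i, a, hx, ha⟩ := exists_norm_lt_of_infNorm_lt
          (lt_add_of_pos_right (infNorm f x) hε)
        have : infNorm f (c • x) ≤ ‖c • a‖ := by
          rw [← hx, DirectLimit.smul_def]
          exact infNorm_mk_le f (c • a)
        exact this.trans ((norm_smul_le c a).trans (by gcongr)) }
  let : NormedAlgebra ℂ (UniformSpace.Completion (DirectLimit R f)) :=
    { UniformSpace.Completion.algebra (DirectLimit R f) ℂ with
      norm_smul_le := norm_smul_le }
  let ι : ∀ i, R i →ₐ[ℂ] UniformSpace.Completion (DirectLimit R f) := fun i =>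
    { UniformSpace.Completion.coeRingHom.comp (Algebra.of R f i : R i →+* DirectLimit R f) with
      commutes' := fun r => by
        exact congrArg ((↑) : DirectLimit R f → UniformSpace.Completion (DirectLimit R f))
          ((Algebra.of R f i).commutes r) }
  have hι : ∀ i a, ‖ι i a‖ = infNorm f (Quotient.mk _ ⟨i, a⟩ : DirectLimit R f) :=
    fun i a => UniformSpace.Completion.norm_coe _
  refine ⟨UniformSpace.Completion (DirectLimit R f), inferInstance, inferInstance, inferInstance,
    ι, ?_, ?_, ?_, ?_⟩
  · intro i a
    rw [hι]
    exact infNorm_mk_le f a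
  · intro i j h a
    exact congrArg ((↑) : DirectLimit R f → UniformSpace.Completion (DirectLimit R f))
      (DirectLimit.eq_of_le (f := f) ⟨i, a⟩ j h).symm
  · intro i a ε h
    rw [hι] at h
    obtain ⟨j, b, hb, hb'⟩ := exists_norm_lt_of_infNorm_lt h
    -- The small representative `b` may live at an unrelated stage. It agrees with `a` at a common
    -- later stage, where contractivity carries over its bound.
    obtain ⟨k, hjk, hik, e⟩ := Quotient.exact hb
    refine ⟨k, hik, ?_⟩
    change f j k hjk b = f i k hik a at e
    rw [← e]
    exact (hf _ _ _ _).trans_lt hb'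
  · intro B _ _ _ γ hγ hγc
    let g₀ : DirectLimit R f →ₐ[ℂ] B := Algebra.lift R f B γ hγc
    have hg₀ : ∀ x, ‖g₀ x‖ ≤ ‖x‖ := by
      intro x
      refine le_of_forall_gt fun ε hε => ?_
      obtain ⟨i, a, rfl, ha⟩ := exists_norm_lt_of_infNorm_lt hε
      exact (hγ i a).trans_lt ha
    have hc := AddMonoidHomClass.continuous_of_bound (g₀ : DirectLimit R f →+* B) 1
      fun x => (hg₀ x).trans (one_mul _).ge
    let g := UniformSpace.Completion.extensionHom (g₀ : DirectLimit R f →+* B) hc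
    have hg : ∀ x : DirectLimit R f, g x = g₀ x :=
      UniformSpace.Completion.extensionHom_coe (g₀ : DirectLimit R f →+* B) hc
    refine ⟨{ g with commutes' := fun r => ?_ }, ?_, ?_⟩
    · exact (hg (algebraMap ℂ _ r)).trans (g₀.commutes r)
    · intro x
      induction x using UniformSpace.Completion.induction_on with
      | hp =>
        exact isClosed_le (UniformSpace.Completion.continuous_extension.norm) continuous_norm
      | ih x =>
        change ‖g x‖ ≤ _
        rw [hg, UniformSpace.Completion.norm_coe]
        exact hg₀ x
    · intro i a
      exact hg _

end DirectLimit

/-! ### Direct limits of Banach algebras -/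

namespace Plus

variable {A : Type*} [NonUnitalNormedRing A] [NormedSpace ℂ A] [IsScalarTower ℂ A A]
  [SMulCommClass ℂ A A] {B : Type*} [NonUnitalNormedRing B] [NormedSpace ℂ B]
  [IsScalarTower ℂ B B] [SMulCommClass ℂ B B]

/-- `Plus.map` as a homomorphism of `ℂ`-algebras. -/
def mapAlg (φ : ContrHom A B) : Plus A →ₐ[ℂ] Plus B where
  __ := map φ
  commutes' r := by
    refine ext_fst_snd ?_ ?_
    · exact fst_map φ _
    · exact (snd_map φ _).trans (map_zero φ)

theorem map_inr (φ : ContrHom A B) (a : A) : map φ (inr A a) = inr B (φ a) :=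
  ext_fst_snd (fst_map φ _) (snd_map φ _)

theorem norm_snd_le (x : Plus A) : ‖(WithLp.ofLp x).snd‖ ≤ ‖x‖ := by
  rw [WithLp.unitization_norm_def x]
  exact le_add_of_nonneg_left (norm_nonneg _)

theorem norm_scalar_le (x : Plus A) : ‖scalar A x‖ ≤ ‖x‖ := by
  rw [WithLp.unitization_norm_def x]
  exact le_add_of_nonneg_right (norm_nonneg _)

theorem norm_inr (a : A) : ‖inr A a‖ = ‖a‖ := WithLp.unitization_norm_inr a

end Plus

section

variable {I : Type v} [Preorder I] [IsDirectedOrder I] [Nonempty I] {A : I → Type u}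
  [∀ i, NonUnitalNormedRing (A i)] [∀ i, NormedSpace ℂ (A i)]
  [∀ i, IsScalarTower ℂ (A i) (A i)] [∀ i, SMulCommClass ℂ (A i) (A i)]

/-- The unital limit `E` of the unitizations is formed, and `L` is the closure in `E` of the images
of the `A i`. A compatible family into `B` extends to unital maps into `Plus B`, hence to `E`;
restricted to `L` it lands in `B`. -/
theorem exists_isBanachDirectLimit (φ : ∀ i j, i ≤ j → ContrHom (A i) (A j))
    [DirectedSystem A (fun i j h => φ i j h)] :
    ∃ (L : Type (max u v)) (_ : NonUnitalNormedRing L) (_ : NormedSpace ℂ L)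
      (_ : IsScalarTower ℂ L L) (_ : SMulCommClass ℂ L L) (_ : CompleteSpace L)
      (ψ : ∀ i, ContrHom (A i) L), IsBanachDirectLimit φ L ψ ∧ IsBanachApproxLimit φ ψ := by
  have hmm : ∀ i j k (hij : i ≤ j) (hjk : j ≤ k) (a : A i),
      φ j k hjk (φ i j hij a) = φ i k (hij.trans hjk) a := fun i j k hij hjk a =>
    DirectedSystem.map_map (f := fun i j h => φ i j h) hij hjk a
  let f : ∀ i j, i ≤ j → Plus (A i) →ₐ[ℂ] Plus (A j) := fun i j h => Plus.mapAlg (φ i j h)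
  have : DirectedSystem (fun i => Plus (A i)) (fun i j h => f i j h) :=
    { map_self := fun i x => by
        refine Plus.ext_fst_snd (Plus.fst_map _ _) ((Plus.snd_map _ _).trans ?_)
        exact DirectedSystem.map_self (f := fun i j h => φ i j h) _
      map_map := fun k j i hij hjk x => by
        refine Plus.ext_fst_snd ?_ ?_
        · exact ((Plus.fst_map _ _).trans (Plus.fst_map _ _)).trans (Plus.fst_map _ _).symm
        · refine (Plus.snd_map _ _).trans ?_
          rw [show (WithLp.ofLp (f i j hij x)).snd = _ from Plus.snd_map _ _, hmm]
          exact (Plus.snd_map _ _).symm }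
  obtain ⟨E, _, _, _, ι, hι, hιc, hιn, hE⟩ := DirectLimit.exists_completion (f := f)
    (fun i j h a => Plus.norm_map_le (φ i j h) a)
  have hfi : ∀ i j (h : i ≤ j) (a : A i), ι j (Plus.inr _ (φ i j h a)) = ι i (Plus.inr _ a) := by
    intro i j h a
    rw [← hιc i j h]
    exact congrArg (ι j) (Plus.map_inr (φ i j h) a).symm
  let s : NonUnitalSubalgebra ℂ E :=
    { carrier := {x | ∃ i, ∃ a : A i, ι i (Plus.inr _ a) = x}
      add_mem' := by
        rintro _ _ ⟨i, a, rfl⟩ ⟨j, b, rfl⟩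
        obtain ⟨k, hik, hjk⟩ := exists_ge_ge i j
        exact ⟨k, φ i k hik a + φ j k hjk b, by rw [map_add, map_add, hfi, hfi]⟩
      zero_mem' := ⟨Classical.arbitrary I, 0, by rw [map_zero, map_zero]⟩
      mul_mem' := by
        rintro _ _ ⟨i, a, rfl⟩ ⟨j, b, rfl⟩
        obtain ⟨k, hik, hjk⟩ := exists_ge_ge i j
        exact ⟨k, φ i k hik a * φ j k hjk b, by rw [map_mul, map_mul, hfi, hfi]⟩
      smul_mem' := by
        rintro c _ ⟨i, a, rfl⟩
        refine ⟨i, c • a, ?_⟩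
        rw [← map_smul]
        refine congrArg (ι i) (Plus.ext_fst_snd ?_ rfl)
        exact (mul_zero c).symm }
  let L := s.topologicalClosure
  have hL : IsClosed (L : Set E) := s.isClosed_topologicalClosure
  let : NormedSpace ℂ L := { norm_smul_le := fun c x => norm_smul_le c (x : E) }
  let ψ : ∀ i, ContrHom (A i) L := fun i =>
    { toFun := fun a => ⟨ι i (Plus.inr _ a), s.le_topologicalClosure ⟨i, a, rfl⟩⟩
      map_smul' := fun c a => by
        refine Subtype.ext ?_
        change ι i (Plus.inr _ (c • a)) = c • ι i (Plus.inr _ a)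
        rw [← map_smul]
        refine congrArg (ι i) (Plus.ext_fst_snd ?_ rfl)
        exact (mul_zero c).symm
      map_zero' := Subtype.ext (by
        change ι i (Plus.inr _ 0) = 0
        rw [map_zero, map_zero])
      map_add' := fun a b => Subtype.ext (by
        change ι i (Plus.inr _ (a + b)) = ι i (Plus.inr _ a) + ι i (Plus.inr _ b)
        rw [map_add, map_add])
      map_mul' := fun a b => Subtype.ext (by
        change ι i (Plus.inr _ (a * b)) = ι i (Plus.inr _ a) * ι i (Plus.inr _ b)
        rw [map_mul, map_mul])
      norm_le := fun a => (hι i _).trans (Plus.norm_inr a).le }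
  have hψ : ∀ i a, ((ψ i a : L) : E) = ι i (Plus.inr _ a) := fun i a => rfl
  have hdense : ∀ y : L, ∀ ε > 0, ∃ i, ∃ a : A i, ‖ψ i a - y‖ < ε := by
    intro y ε hε
    obtain ⟨_, ⟨i, a, rfl⟩, h⟩ := Metric.mem_closure_iff.1 y.2 ε hε
    rw [dist_comm, dist_eq_norm] at h
    exact ⟨i, a, h⟩
  have happrox : IsBanachApproxLimit φ ψ :=
    { map_map := hmm
      compat := fun i j h a => Subtype.ext (hfi i j h a)
      dense := hdense
      norm := fun i a ε h => by
        obtain ⟨k, hik, hk⟩ := hιn i (Plus.inr _ a) ε h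
        refine ⟨k, hik, ?_⟩
        rwa [show f i k hik (Plus.inr _ a) = _ from Plus.map_inr (φ i k hik) a, Plus.norm_inr] at hk }
  refine ⟨L, inferInstance, inferInstance, inferInstance, inferInstance, hL.completeSpace_coe, ψ,
    ⟨happrox.compat, ?_⟩, happrox⟩
  intro B _ _ _ _ _ γ hγ
  obtain ⟨g, hg, hgι⟩ := hE (Plus B) (fun i => Plus.mapAlg (γ i))
    (fun i a => Plus.norm_map_le (γ i) a) (fun i j h a => by
      refine Plus.ext_fst_snd ?_ ?_
      · exact ((Plus.fst_map _ _).trans (Plus.fst_map _ _)).trans (Plus.fst_map _ _).symm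
      · refine (Plus.snd_map _ _).trans ?_
        rw [show (WithLp.ofLp (f i j h a)).snd = _ from Plus.snd_map _ _, hγ]
        exact (Plus.snd_map _ _).symm)
  have hgc : Continuous g := AddMonoidHomClass.continuous_of_bound g 1 fun x => by
    simpa using hg x
  have hgψ : ∀ i a, g (ψ i a : L) = Plus.inr B (γ i a) := fun i a =>
    (hgι i _).trans (Plus.map_inr (γ i) a)
  -- The scalar component vanishes on the images of the `A i` and is continuous, so it vanishes on
  -- `L`; this is what makes the second component multiplicative there.
  have hscalar : ∀ x : L, Plus.scalar B (g x) = 0 := by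
    have hc : Continuous (Plus.scalar B) := AddMonoidHomClass.continuous_of_bound _ 1 fun x => by
      simpa using Plus.norm_scalar_le x
    have h : (L : Set E) ⊆ {x | Plus.scalar B (g x) = 0} := by
      refine closure_minimal ?_ (isClosed_eq (hc.comp hgc) continuous_const)
      rintro _ ⟨i, a, rfl⟩
      change Plus.scalar B (g _) = 0
      rw [← hψ, hgψ]
      rfl
    exact fun x => h x.2
  have hsnd : ∀ x : L, g x = Plus.inr B (WithLp.ofLp (g x)).snd := fun x =>
    Plus.ext_fst_snd (hscalar x) rfl
  let G : ContrHom L B :=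
    { toFun := fun x => (WithLp.ofLp (g x)).snd
      map_smul' := fun c x => by
        change (WithLp.ofLp (g (c • (x : E)))).snd = _
        rw [map_smul]
        rfl
      map_zero' := by
        change (WithLp.ofLp (g 0)).snd = _
        rw [map_zero]
        rfl
      map_add' := fun x y => by
        change (WithLp.ofLp (g ((x : E) + y))).snd = _
        rw [map_add]
        rfl
      map_mul' := fun x y => by
        change (WithLp.ofLp (g ((x : E) * y))).snd = _
        rw [map_mul, hsnd x, hsnd y, ← map_mul]
        rfl
      norm_le := fun x => (Plus.norm_snd_le _).trans (hg x) }
  have hG : ∀ i a, G (ψ i a) = γ i a := fun i a => by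
    change (WithLp.ofLp (g (ψ i a : L))).snd = _
    rw [hgψ]
    rfl
  refine ⟨G, hG, fun G' hG' => ?_⟩
  refine DFunLike.coe_injective (Continuous.ext_on (s := {y : L | ∃ i, ∃ a, ψ i a = y}) ?_
    G'.continuous G.continuous ?_)
  · intro y
    refine Metric.mem_closure_iff.2 fun ε hε => ?_
    obtain ⟨i, a, h⟩ := hdense y ε hε
    exact ⟨_, ⟨i, a, rfl⟩, by rwa [dist_comm, dist_eq_norm]⟩
  · rintro _ ⟨i, a, rfl⟩
    exact (hG' i a).trans (hG i a).symm

/-- A direct limit of Banach algebras is approximated by the system. -/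
theorem IsBanachDirectLimit.isBanachApproxLimit {φ : ∀ i j, i ≤ j → ContrHom (A i) (A j)}
    [DirectedSystem A (fun i j h => φ i j h)] {L : Type (max u v)} [NonUnitalNormedRing L]
    [NormedSpace ℂ L] [IsScalarTower ℂ L L] [SMulCommClass ℂ L L] [CompleteSpace L]
    {ψ : ∀ i, ContrHom (A i) L} (hL : IsBanachDirectLimit φ L ψ) : IsBanachApproxLimit φ ψ := by
  obtain ⟨L₀, _, _, _, _, _, ψ₀, hL₀, H⟩ := exists_isBanachDirectLimit φ
  obtain ⟨g, hg, -⟩ := hL.existsUnique L₀ ψ₀ hL₀.compat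
  obtain ⟨g₀, hg₀, -⟩ := hL₀.existsUnique L ψ hL.compat
  -- One composite is enough: applying the contraction `g₀` to approximants of `g y` gives density
  -- in `L`, and contractivity of `g` bounds the norm in `L₀` by that in `L`.
  have hid : g₀.comp g = ContrHom.id L :=
    (hL.existsUnique L ψ hL.compat).unique (fun i a => by
      change g₀ (g (ψ i a)) = _
      rw [hg, hg₀]) (fun i a => rfl)
  refine ⟨H.map_map, hL.compat, fun y ε hε => ?_, fun i a ε h => ?_⟩
  · obtain ⟨i, a, h⟩ := H.dense (g y) ε hε
    refine ⟨i, a, ?_⟩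
    have hy : g₀ (g y) = y := DFunLike.congr_fun hid y
    rw [← hg₀, ← hy, ← map_sub]
    exact (g₀.norm_apply_le _).trans_lt h
  · refine H.norm i a ε ?_
    rw [← hg]
    exact (g.norm_apply_le _).trans_lt h

end

/-! ### `K₁` of finite-dimensional algebras -/

/-- An element and its left multiplication operator are invertible together, and an operator on a
finite-dimensional space has finitely many spectral values. -/
theorem finite_spectrum_of_finiteDimensional {E : Type*} [Ring E] [Algebra ℂ E]
    [FiniteDimensional ℂ E] (a : E) : (spectrum ℂ a).Finite := by
  refine (Module.End.finite_spectrum (Algebra.lmul ℂ E a)).subset fun z hz => ?_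
  rw [spectrum.mem_iff] at hz ⊢
  rwa [← AlgHom.commutes (Algebra.lmul ℂ E), ← map_sub, Algebra.lmul_isUnit_iff]

/-- For `z ≠ 0`, `1 + za = z(z⁻¹ - (-a))` is singular only when `z⁻¹` is in the finite spectrum of
`-a`. The complement of a countable set in `ℂ`, of real dimension two, is path connected. -/
theorem isPreconnected_setOf_isUnit_one_add_smul {E : Type*} [Ring E] [Algebra ℂ E]
    [FiniteDimensional ℂ E] (a : E) : IsPreconnected {z : ℂ | IsUnit (1 + z • a)} := by
  have hfin : {z : ℂ | IsUnit (1 + z • a)}ᶜ.Countable := by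
    refine (((finite_spectrum_of_finiteDimensional (-a)).preimage
      inv_injective.injOn).subset fun z hz => ?_).countable
    simp only [Set.mem_compl_iff, Set.mem_ofPred_eq] at hz
    have hz0 : z ≠ 0 := by
      rintro rfl
      simp at hz
    rw [Set.mem_preimage, spectrum.mem_iff]
    intro h
    refine hz ?_
    have := (IsUnit.mk0 z hz0).map (algebraMap ℂ E) |>.mul h
    rwa [mul_sub, ← map_mul, mul_inv_cancel₀ hz0, map_one, mul_neg, sub_neg_eq_add,
      ← Algebra.smul_def] at this
  have h := hfin.isPathConnected_compl_of_one_lt_rank (by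
    rw [Complex.rank_real_complex]
    exact Nat.one_lt_ofNat)
  rw [compl_compl] at h
  exact h.isConnected.isPreconnected

/-- The line through `1` and `x` already joins them inside `GLPlus A n`; no larger matrices are
needed. -/
theorem K1.eq_one_of_finiteDimensional {A : Type*} [NonUnitalNormedRing A] [NormedSpace ℂ A]
    [IsScalarTower ℂ A A] [SMulCommClass ℂ A A] [FiniteDimensional ℂ A] (z : K1 A) : z = 1 := by
  have : CompleteSpace A := FiniteDimensional.complete ℂ A
  have : FiniteDimensional ℂ (Unitization ℂ A) :=
    Module.Finite.equiv (Unitization.linearEquiv ℂ ℂ A).symm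
  have : FiniteDimensional ℂ (Plus A) :=
    Module.Finite.equiv (WithLp.linearEquiv 1 ℂ (Unitization ℂ A)).symm
  obtain ⟨n, x, rfl⟩ := K1.exists_mk_eq z
  have hx : x⁻¹ * 1 ∈ Subgroup.connectedComponentOfOne (GLPlus A n) := by
    rw [mul_one]
    refine inv_mem (GLPlus.mem_connectedComponentOfOne_of_isPreconnected
      (isPreconnected_setOf_isUnit_one_add_smul (x.1.1 - 1)) ?_ ?_ fun z hz => hz)
    · simp
    · simp
  rw [K1.mk_eq_mk hx, K1.mk_eq_one_iff]
  exact ⟨n, le_rfl, by rw [map_one]; exact one_mem _⟩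

/-! ### `K₀` of matrix algebras -/

/-- A projection factors through its range as corestriction followed by inclusion, and in the other
order these compose to the identity of the range. -/
theorem Matrix.exists_eq_mul_of_idempotent {ι : Type*} [Fintype ι] [DecidableEq ι]
    {M : Matrix ι ι ℂ} (hM : M * M = M) :
    ∃ (r : ℕ) (x : Matrix ι (Fin r) ℂ) (y : Matrix (Fin r) ι ℂ), M = x * y ∧ y * x = 1 := by
  let f := Matrix.toLin' M
  have hf : f ∘ₗ f = f := by rw [← Matrix.toLin'_mul, hM]
  let b := Module.finBasis ℂ (LinearMap.range f)
  let c := Pi.basisFun ℂ ι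
  refine ⟨_, LinearMap.toMatrix b c (LinearMap.range f).subtype,
    LinearMap.toMatrix c b f.rangeRestrict, ?_, ?_⟩
  · rw [← LinearMap.toMatrix_comp c b c]
    have : (LinearMap.range f).subtype ∘ₗ f.rangeRestrict = f := by ext; rfl
    rw [this]
    exact (LinearMap.toMatrix'_toLin' M).symm
  · rw [← LinearMap.toMatrix_comp b c b]
    have : f.rangeRestrict ∘ₗ (LinearMap.range f).subtype = LinearMap.id := by
      refine LinearMap.ext ?_
      rintro ⟨_, v, rfl⟩
      exact Subtype.ext (LinearMap.congr_fun hf v)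
    rw [this, LinearMap.toMatrix_id]

theorem Matrix.comp_mul {I J K M R : Type*} [Fintype J] [Fintype K] [NonUnitalNonAssocSemiring R]
    (X : Matrix I J (Matrix K K R)) (Y : Matrix J M (Matrix K K R)) :
    Matrix.comp I M K K R (X * Y) = Matrix.comp I J K K R X * Matrix.comp J M K K R Y := by
  ext ⟨i, k⟩ ⟨j, l⟩
  simp [Matrix.mul_apply, Matrix.sum_apply, Fintype.sum_prod_type]

namespace VMonoid

variable {d : ℕ}

/-- The trace of idempotent matrices over `M_d(ℂ)`. -/
def trace (d : ℕ) : VMonoid (Matrix (Fin d) (Fin d) ℂ) →+ ℂ where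
  toFun := Quotient.lift (fun e : IdemMatrix (Matrix (Fin d) (Fin d) ℂ) =>
      (Matrix.comp _ _ _ _ _ e.mat).trace) (by
    rintro e f ⟨x, y, h1, h2⟩
    simp only [h1, h2, Matrix.comp_mul]
    exact Matrix.trace_mul_comm _ _)
  map_zero' := by
    change Matrix.trace _ = 0
    simp [Matrix.trace]
  map_add' := by
    rintro ⟨e⟩ ⟨f⟩
    change (Matrix.comp _ _ _ _ _ (e.dsum f).mat).trace =
      (Matrix.comp _ _ _ _ _ e.mat).trace + (Matrix.comp _ _ _ _ _ f.mat).trace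
    simp [Matrix.trace, Fintype.sum_prod_type, Fin.sum_univ_add]

theorem comp_idem (e : IdemMatrix (Matrix (Fin d) (Fin d) ℂ)) :
    Matrix.comp _ _ _ _ _ e.mat * Matrix.comp _ _ _ _ _ e.mat = Matrix.comp _ _ _ _ _ e.mat := by
  rw [← Matrix.comp_mul, e.idem]

theorem exists_trace_eq_natCast (x : VMonoid (Matrix (Fin d) (Fin d) ℂ)) :
    ∃ r : ℕ, trace d x = r := by
  obtain ⟨e⟩ := x
  obtain ⟨r, x, y, hxy, hyx⟩ := Matrix.exists_eq_mul_of_idempotent (comp_idem e)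
  refine ⟨r, ?_⟩
  change (Matrix.comp _ _ _ _ _ e.mat).trace = _
  rw [hxy, Matrix.trace_mul_comm, hyx]
  simp

/-- The trace of an idempotent is its rank. Two idempotents `xy` and `zw` of the same rank, with `yx
= 1` and `wz = 1`, are equivalent through `xw` and `zy`. Injectivity on the semigroup itself yields
cancellation. -/
theorem trace_injective : Function.Injective (trace d) := by
  rintro ⟨e⟩ ⟨f⟩ h
  change (Matrix.comp _ _ _ _ _ e.mat).trace = (Matrix.comp _ _ _ _ _ f.mat).trace at h
  obtain ⟨r, x, y, hxy, hyx⟩ := Matrix.exists_eq_mul_of_idempotent (comp_idem e)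
  obtain ⟨s, z, w, hzw, hwz⟩ := Matrix.exists_eq_mul_of_idempotent (comp_idem f)
  have hrs : r = s := by
    rw [hxy, hzw, Matrix.trace_mul_comm, Matrix.trace_mul_comm z, hyx, hwz] at h
    simpa using h
  subst hrs
  refine Quotient.sound ⟨(Matrix.comp _ _ _ _ _).symm (x * w), (Matrix.comp _ _ _ _ _).symm (z * y),
    ?_, ?_⟩
  · refine (Matrix.comp _ _ _ _ _).injective ?_
    rw [Matrix.comp_mul, Equiv.apply_symm_apply, Equiv.apply_symm_apply, Matrix.mul_assoc, ← Matrix.mul_assoc w, hwz,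
      Matrix.one_mul, hxy]
  · refine (Matrix.comp _ _ _ _ _).injective ?_
    rw [Matrix.comp_mul, Equiv.apply_symm_apply, Equiv.apply_symm_apply, Matrix.mul_assoc, ← Matrix.mul_assoc y, hyx,
      Matrix.one_mul, hzw]

theorem map_injective_of_leftInverse {R S : Type*} [NonUnitalRing R] [NonUnitalRing S]
    (f : R →ₙ+* S) (g : S →ₙ+* R) (h : g.comp f = NonUnitalRingHom.id R) :
    Function.Injective (map f) := by
  refine Function.LeftInverse.injective (g := map g) fun x => ?_
  rw [← AddMonoidHom.comp_apply, ← map_comp, h, map_id]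
  rfl

end VMonoid

namespace VMonoid

theorem map_injective_of_ringEquiv {R S : Type*} [Ring R] [Ring S] (e : R ≃+* S) :
    Function.Injective (map ((e : R →+* S) : R →ₙ+* S)) :=
  map_injective_of_leftInverse _ ((e.symm : S →+* R) : S →ₙ+* R)
    (NonUnitalRingHom.ext fun x => e.symm_apply_apply x)

/-- The trace of idempotent matrices over a ring isomorphic to `M_d(ℂ)`. -/
def traceOfEquiv {R : Type*} [Ring R] {d : ℕ} (e : R ≃+* Matrix (Fin d) (Fin d) ℂ) :
    VMonoid R →+ ℂ :=
  (trace d).comp (map ((e : R →+* Matrix (Fin d) (Fin d) ℂ) : R →ₙ+* Matrix (Fin d) (Fin d) ℂ))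

theorem traceOfEquiv_injective {R : Type*} [Ring R] {d : ℕ} (e : R ≃+* Matrix (Fin d) (Fin d) ℂ) :
    Function.Injective (traceOfEquiv e) :=
  trace_injective.comp (map_injective_of_ringEquiv e)

end VMonoid

/-! ### Unitization of a unital algebra -/

namespace Plus

variable (A : Type*) [NormedRing A] [NormedAlgebra ℂ A]

/-- The homomorphism `(λ, a) ↦ λ 1 + a` from the unitization of a unital algebra. -/
def toUnital : Plus A →+* A where
  toFun x := algebraMap ℂ A (WithLp.ofLp x).fst + (WithLp.ofLp x).snd
  map_one' := by
    change algebraMap ℂ A 1 + 0 = 1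
    simp
  map_mul' x y := by
    change algebraMap ℂ A ((WithLp.ofLp x).fst * (WithLp.ofLp y).fst) +
      ((WithLp.ofLp x).fst • (WithLp.ofLp y).snd + (WithLp.ofLp y).fst • (WithLp.ofLp x).snd +
        (WithLp.ofLp x).snd * (WithLp.ofLp y).snd) = _
    simp only [Algebra.smul_def, map_mul, Algebra.commutes (WithLp.ofLp y).fst (WithLp.ofLp x).snd]
    noncomm_ring
  map_zero' := by
    change algebraMap ℂ A 0 + 0 = 0
    simp
  map_add' x y := by
    change algebraMap ℂ A ((WithLp.ofLp x).fst + (WithLp.ofLp y).fst) +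
      ((WithLp.ofLp x).snd + (WithLp.ofLp y).snd) = _
    rw [map_add]
    abel

theorem toUnital_inr (a : A) : toUnital A (inr A a) = a := by
  change algebraMap ℂ A 0 + a = a
  simp

variable {A}

theorem ext_scalar_toUnital {x y : Plus A} (h : scalar A x = scalar A y)
    (h' : toUnital A x = toUnital A y) : x = y := by
  have hf : (WithLp.ofLp x).fst = (WithLp.ofLp y).fst := h
  refine ext_fst_snd hf ?_
  change algebraMap ℂ A (WithLp.ofLp x).fst + (WithLp.ofLp x).snd =
    algebraMap ℂ A (WithLp.ofLp y).fst + (WithLp.ofLp y).snd at h'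
  rwa [hf, add_right_inj] at h'

theorem exists_scalar_toUnital (c : ℂ) (a : A) :
    ∃ x : Plus A, scalar A x = c ∧ toUnital A x = a := by
  refine ⟨WithLp.toLp 1 (Unitization.inl c + ((a - algebraMap ℂ A c : A) : Unitization ℂ A)), ?_, ?_⟩
  · change c + 0 = c
    simp
  · change algebraMap ℂ A (c + 0) + (0 + (a - algebraMap ℂ A c)) = a
    simp

/-- For unital `A`, the pair of `scalar` and `toUnital` identifies `Plus A` with `ℂ × A`, so
equivalences over the two factors combine entrywise. -/
theorem vMonoid_ext {x y : VMonoid (Plus A)}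
    (h : VMonoid.map (scalar A : Plus A →ₙ+* ℂ) x = VMonoid.map (scalar A : Plus A →ₙ+* ℂ) y)
    (h' : VMonoid.map (toUnital A : Plus A →ₙ+* A) x = VMonoid.map (toUnital A : Plus A →ₙ+* A) y) :
    x = y := by
  obtain ⟨e⟩ := x
  obtain ⟨f⟩ := y
  obtain ⟨a, b, hab, hba⟩ := Quotient.exact h
  obtain ⟨c, d, hcd, hdc⟩ := Quotient.exact h'
  choose z hz hz' using exists_scalar_toUnital (A := A)
  refine Quotient.sound ⟨Matrix.of fun i j => z (a i j) (c i j),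
    Matrix.of fun i j => z (b i j) (d i j), ?_, ?_⟩
  · ext i j : 2
    refine ext_scalar_toUnital ?_ ?_
    · refine (congrFun₂ hab i j).trans ?_
      simp [Matrix.mul_apply, hz]
    · refine (congrFun₂ hcd i j).trans ?_
      simp [Matrix.mul_apply, hz']
  · ext i j : 2
    refine ext_scalar_toUnital ?_ ?_
    · refine (congrFun₂ hba i j).trans ?_
      simp [Matrix.mul_apply, hz]
    · refine (congrFun₂ hdc i j).trans ?_
      simp [Matrix.mul_apply, hz']

end Plus

/-! ### `K0` of an algebra isomorphic to a full matrix algebra -/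

namespace K0

variable {A : Type*} [NormedRing A] [NormedAlgebra ℂ A] {d : ℕ}

/-- The homomorphism `K₀₀(A⁺) → ℂ` induced by the trace of `A ≅ M_d(ℂ)`. -/
def trace (e : A ≃+* Matrix (Fin d) (Fin d) ℂ) : K00 (Plus A) →+ ℂ :=
  Algebra.GrothendieckAddGroup.lift
    ((VMonoid.traceOfEquiv e).comp (VMonoid.map (Plus.toUnital A : Plus A →ₙ+* A)))

theorem trace_of (e : A ≃+* Matrix (Fin d) (Fin d) ℂ) (x : VMonoid (Plus A)) :
    trace e (.of x) = VMonoid.traceOfEquiv e (VMonoid.map (Plus.toUnital A : Plus A →ₙ+* A) x) :=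
  DFunLike.congr_fun (Algebra.GrothendieckAddGroup.lift.symm_apply_apply _) x

theorem trace_idemClass (e : A ≃+* Matrix (Fin d) (Fin d) ℂ) (a : A) (ha : a * a = a) :
    trace e (idemClass a ha).1 = (e a).trace := by
  refine (trace_of e _).trans ?_
  change (Matrix.comp _ _ _ _ _ ((((IdemMatrix.single a ha).map (Plus.inr A)).map
    (Plus.toUnital A : Plus A →ₙ+* A)).map
      ((e : A →+* Matrix (Fin d) (Fin d) ℂ) : A →ₙ+* Matrix (Fin d) (Fin d) ℂ)).mat).trace = _
  simp only [Matrix.trace, Fintype.sum_prod_type, Matrix.diag_apply, Matrix.comp_apply,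
    Matrix.map_apply]
  refine (Fin.sum_univ_one _).trans ?_
  refine Finset.sum_congr rfl fun i _ => ?_
  change e (Plus.toUnital A (Plus.inr A a)) i i = e a i i
  rw [Plus.toUnital_inr]

theorem trace_injective (e : A ≃+* Matrix (Fin d) (Fin d) ℂ) {x : K0 A} (hx : trace e x.1 = 0) :
    x = 0 := by
  refine Subtype.ext ?_
  obtain ⟨x, hx'⟩ := x
  obtain ⟨a, b, rfl⟩ := K00.exists_eq_sub x
  rw [AddMonoidHom.mem_ker, map_sub, sub_eq_zero, K00.map_of, K00.map_of, K00.of_eq_of_iff] at hx'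
  obtain ⟨c, hc⟩ := hx'
  simp only [map_sub, trace_of, sub_eq_zero] at hx
  -- With `ℂ` seen as 1 × 1 matrices, the trace takes values in a group, so the stabilizing class
  -- `c` cancels and the scalar parts agree.
  have h1 := congrArg (VMonoid.traceOfEquiv
    (Matrix.uniqueRingEquiv (m := Fin 1) (A := ℂ)).symm) hc
  rw [map_add, map_add, add_right_inj] at h1
  have := Plus.vMonoid_ext (VMonoid.traceOfEquiv_injective _ h1)
    (VMonoid.traceOfEquiv_injective e hx)
  subst this
  exact sub_self _

/-- `K₀` of an algebra isomorphic to `M_d(ℂ)`. -/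
theorem exists_equiv_int (e : A ≃+* Matrix (Fin d) (Fin d) ℂ) (hd : 0 < d) :
    ∃ σ : K0 A ≃+ ℤ, σ (idemClass 1 (one_mul 1)) = d := by
  have hint : ∀ x : K0 A, ∃ m : ℤ, (m : ℂ) = trace e x.1 := by
    rintro ⟨x, -⟩
    obtain ⟨a, b, rfl⟩ := K00.exists_eq_sub x
    obtain ⟨r, hr⟩ := VMonoid.exists_trace_eq_natCast (VMonoid.map
      ((e : A →+* Matrix (Fin d) (Fin d) ℂ) : A →ₙ+* Matrix (Fin d) (Fin d) ℂ)
        (VMonoid.map (Plus.toUnital A : Plus A →ₙ+* A) a))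
    obtain ⟨s, hs⟩ := VMonoid.exists_trace_eq_natCast (VMonoid.map
      ((e : A →+* Matrix (Fin d) (Fin d) ℂ) : A →ₙ+* Matrix (Fin d) (Fin d) ℂ)
        (VMonoid.map (Plus.toUnital A : Plus A →ₙ+* A) b))
    refine ⟨r - s, ?_⟩
    rw [map_sub, trace_of, trace_of]
    push_cast
    rw [← hr, ← hs]
    rfl
  choose σ hσ using hint
  let σ' : K0 A →+ ℤ := AddMonoidHom.mk' σ fun x y => by
    refine Int.cast_injective (α := ℂ) ?_
    rw [Int.cast_add, hσ, hσ, hσ]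
    exact map_add (trace e) x.1 y.1
  have hinj : Function.Injective σ' := by
    rw [injective_iff_map_eq_zero]
    intro x hx
    refine trace_injective e ?_
    rw [← hσ, show σ x = 0 from hx, Int.cast_zero]
  have hsurj : Function.Surjective σ' := by
    -- A rank one idempotent has trace `1` and so generates the image; this is where `0 < d` enters.
    let p : Matrix (Fin d) (Fin d) ℂ := Matrix.single ⟨0, hd⟩ ⟨0, hd⟩ 1
    have hp : e.symm p * e.symm p = e.symm p := by
      rw [← map_mul]
      simp [p]
    have h1 : σ' (idemClass (e.symm p) hp) = 1 := by
      refine Int.cast_injective (α := ℂ) ((hσ _).trans ?_)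
      rw [trace_idemClass, RingEquiv.apply_symm_apply]
      simp [p]
    intro m
    exact ⟨m • idemClass (e.symm p) hp, by rw [map_zsmul, h1]; simp⟩
  refine ⟨AddEquiv.ofBijective σ' ⟨hinj, hsurj⟩, ?_⟩
  refine Int.cast_injective (α := ℂ) ((hσ _).trans ?_)
  rw [trace_idemClass, map_one]
  simp

end K0

/-! ### The algebras `M^p_d` -/

section MatrixLp

open MeasureTheory

/-- Every point has positive mass, so equality almost everywhere is equality of functions. -/
theorem ae_eq_top_normalized_count {d : ℕ} :
    ae ((d : ℝ≥0∞)⁻¹ • (Measure.count : Measure (Fin d))) = ⊤ := by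
  rw [ae_eq_top]
  intro a
  simp

/-- Functions on a finite set as elements of `L^p` of the normalized counting measure. -/
def lpNormalizedCountEquiv (p : ℝ≥0∞) [Fact (1 ≤ p)] {d : ℕ} (hd : 0 < d) :
    Lp ℂ p ((d : ℝ≥0∞)⁻¹ • (Measure.count : Measure (Fin d))) ≃ₗ[ℂ] (Fin d → ℂ) where
  toFun f := f
  invFun f :=
    have : IsFiniteMeasure ((d : ℝ≥0∞)⁻¹ • (Measure.count : Measure (Fin d))) :=
      Measure.smul_finite _ (by simpa using hd.ne')
    (MemLp.of_discrete (p := p) (f := f)).toLp f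
  map_add' f g := by
    have h := Lp.coeFn_add f g
    rwa [EventuallyEq, ae_eq_top_normalized_count, eventually_top, ← funext_iff] at h
  map_smul' c f := by
    have h := Lp.coeFn_smul c f
    rwa [EventuallyEq, ae_eq_top_normalized_count, eventually_top, ← funext_iff] at h
  left_inv f := Lp.toLp_coeFn f _
  right_inv f := by
    have : IsFiniteMeasure ((d : ℝ≥0∞)⁻¹ • (Measure.count : Measure (Fin d))) :=
      Measure.smul_finite _ (by simpa using hd.ne')
    have h := (MemLp.of_discrete (p := p)
      (μ := (d : ℝ≥0∞)⁻¹ • (Measure.count : Measure (Fin d))) (f := f)).coeFn_toLp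
    rwa [EventuallyEq, ae_eq_top_normalized_count, eventually_top, ← funext_iff] at h

/-- The `L^p` space is `ℂ^d` as a vector space, and every endomorphism of a finite-dimensional space
is bounded. -/
theorem nonempty_matrixLp_algEquiv (p : ℝ≥0∞) [Fact (1 ≤ p)] {d : ℕ} (hd : 0 < d) :
    Nonempty (MatrixLp p d ≃ₐ[ℂ] Matrix (Fin d) (Fin d) ℂ) := by
  let b := Module.Basis.ofEquivFun (lpNormalizedCountEquiv p hd)
  have : FiniteDimensional ℂ (Lp ℂ p ((d : ℝ≥0∞)⁻¹ • (Measure.count : Measure (Fin d)))) :=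
    Module.Basis.finiteDimensional_of_finite b
  exact ⟨(Module.End.toContinuousLinearMap _).symm.trans (LinearMap.toMatrixAlgEquiv b)⟩

end MatrixLp

/-! ### Supernatural numbers -/

theorem uhfSeq_pos (enum : ℕ ≃ Nat.Primes) (N : Nat.Primes → ℕ∞) (n : ℕ) : 0 < uhfSeq enum N n :=
  Finset.prod_pos fun k _ => pow_pos (enum k).2.pos _

/-- If `p ^ j` divides `r n` with `j > 0`, then `p` and `j` are at most `r n` and `j ≤ N p`. It
suffices that `k` exceeds `r n` and the indices of all primes up to `r n`. -/
theorem exists_dvd_uhfSeq (enum : ℕ ≃ Nat.Primes) {N : Nat.Primes → ℕ∞} {r : ℕ → ℕ}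
    (hr : ∀ n, 0 < r n)
    (hN : ∀ t : Nat.Primes, N t = ⨆ (m : ℕ) (_ : ∃ n, (t : ℕ) ^ m ∣ r n), (m : ℕ∞)) (n : ℕ) :
    ∃ k, 1 ≤ k ∧ r n ∣ uhfSeq enum N k := by
  obtain ⟨K, hK⟩ : ∃ K, ∀ t : Nat.Primes, (t : ℕ) ≤ r n → enum.symm t ≤ K := by
    have hfin : {t : Nat.Primes | (t : ℕ) ≤ r n}.Finite :=
      (Set.finite_Iic (r n)).preimage Nat.Primes.coe_nat_injective.injOn
    obtain ⟨K, hK⟩ := (hfin.image enum.symm).bddAbove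
    exact ⟨K, fun t ht => hK ⟨t, ht, rfl⟩⟩
  -- The product defining `uhfSeq` runs over indices strictly below `k`; the extra `1` includes
  -- index `K` and ensures `1 ≤ k`.
  refine ⟨K + r n + 1, by omega, ?_⟩
  rw [Nat.dvd_iff_prime_pow_dvd_dvd]
  intro p j hp hpj
  rcases Nat.eq_zero_or_pos j with rfl | hj
  · simp
  let t : Nat.Primes := ⟨p, hp⟩
  have hle := Nat.le_of_dvd (hr n) hpj
  have ht : (t : ℕ) ≤ r n := (Nat.le_self_pow hj.ne' p).trans hle
  have hjr : j ≤ r n := (Nat.lt_pow_self hp.one_lt).le.trans hle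
  have hjN : (j : ℕ∞) ≤ N t := by
    rw [hN t]
    exact le_iSup₂ (f := fun (m : ℕ) (_ : ∃ n, (t : ℕ) ^ m ∣ r n) => (m : ℕ∞)) j ⟨n, hpj⟩
  have hmem : enum.symm t ∈ Finset.range (K + r n + 1) := by
    have := hK t ht
    rw [Finset.mem_range]
    omega
  have hdvd := Finset.dvd_prod_of_mem
    (fun k => (enum k : ℕ) ^ (min (N (enum k)) ((K + r n + 1 : ℕ) : ℕ∞)).toNat) hmem
  refine dvd_trans ?_ hdvd
  simp only [Equiv.apply_symm_apply]
  refine pow_dvd_pow p ?_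
  rw [← Nat.cast_le (α := ℕ∞), ENat.natCast_toNat (ne_top_of_le_ne_top (ENat.natCast_ne_top _)
    (min_le_right _ _))]
  exact le_min hjN (by exact_mod_cast (by omega : j ≤ K + r n + 1))

/-- Truncated at the finite level `k`, the supremum defining `N t` is attained by some `r n`. The
finitely many prime powers are pairwise coprime, so their product divides a later term. -/
theorem exists_uhfSeq_dvd (enum : ℕ ≃ Nat.Primes) {N : Nat.Primes → ℕ∞} {r : ℕ → ℕ}
    (hdvd : ∀ n, r n ∣ r (n + 1))
    (hN : ∀ t : Nat.Primes, N t = ⨆ (m : ℕ) (_ : ∃ n, (t : ℕ) ^ m ∣ r n), (m : ℕ∞)) (k : ℕ) :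
    ∃ n, uhfSeq enum N k ∣ r n := by
  have hmono : ∀ {m n}, m ≤ n → r m ∣ r n := by
    intro m n h
    induction n, h using Nat.le_induction with
    | base => exact dvd_rfl
    | succ n _ ih => exact ih.trans (hdvd n)
  have hex : ∀ t : Nat.Primes, ∃ n, (t : ℕ) ^ (min (N t) (k : ℕ∞)).toNat ∣ r n := by
    intro t
    by_contra! hcon
    set m := (min (N t) (k : ℕ∞)).toNat with hm
    have hmN : (m : ℕ∞) ≤ N t := by
      rw [hm, ENat.natCast_toNat (ne_top_of_le_ne_top (ENat.natCast_ne_top _) (min_le_right _ _))]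
      exact min_le_left _ _
    -- The zeroth power divides everything, so `m - 1` is a genuine predecessor.
    have hm0 : m ≠ 0 := fun h => hcon 0 (by simp [h])
    have hlt : N t ≤ ((m - 1 : ℕ) : ℕ∞) := by
      rw [hN t]
      refine iSup₂_le fun j ⟨n, hj⟩ => ?_
      rw [Nat.cast_le]
      by_contra! h
      exact hcon n ((pow_dvd_pow _ (by omega)).trans hj)
    have := hmN.trans hlt
    rw [Nat.cast_le] at this
    omega
  choose n hn using hex
  refine ⟨(Finset.range k).sup fun i => n (enum i), ?_⟩
  refine Finset.prod_dvd_of_isRelPrime ?_ fun i hi => ?_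
  · intro i _ j _ hij
    refine Nat.coprime_iff_isRelPrime.1 (Nat.Coprime.pow _ _ ?_)
    rw [Nat.coprime_primes (enum i).2 (enum j).2]
    exact fun h => hij (enum.injective (Subtype.ext h))
  · exact (hn (enum i)).trans (hmono (Finset.le_sup (f := fun i => n (enum i)) hi))

theorem setOf_inv_mul_subset {a b : ℕ} (hb : 0 < b) (h : a ∣ b) :
    {x : ℚ | ∃ m : ℤ, x = (a : ℚ)⁻¹ * m} ⊆ {x : ℚ | ∃ m : ℤ, x = (b : ℚ)⁻¹ * m} := by
  rintro _ ⟨m, rfl⟩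
  obtain ⟨c, rfl⟩ := h
  refine ⟨c * m, ?_⟩
  have hac : (a : ℚ) ≠ 0 ∧ (c : ℚ) ≠ 0 := by
    constructor <;> rintro h <;> simp_all
  push_cast
  field_simp [hac.1, hac.2]

theorem iUnion_inv_mul_eq (enum : ℕ ≃ Nat.Primes) {N : Nat.Primes → ℕ∞} {r : ℕ → ℕ}
    (hr : ∀ n, 0 < r n) (hdvd : ∀ n, r n ∣ r (n + 1))
    (hN : ∀ t : Nat.Primes, N t = ⨆ (m : ℕ) (_ : ∃ n, (t : ℕ) ^ m ∣ r n), (m : ℕ∞)) :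
    ⋃ n, {x : ℚ | ∃ m : ℤ, x = (r n : ℚ)⁻¹ * m} =
      ⋃ n ∈ Set.Ici 1, {x : ℚ | ∃ m : ℤ, x = (uhfSeq enum N n : ℚ)⁻¹ * m} := by
  refine Set.Subset.antisymm (Set.iUnion_subset fun n => ?_) (Set.iUnion₂_subset fun k _ => ?_)
  · obtain ⟨k, hk, hk'⟩ := exists_dvd_uhfSeq enum hr hN n
    exact (setOf_inv_mul_subset (uhfSeq_pos enum N k) hk').trans
      (Set.subset_biUnion_of_mem (u := fun n : ℕ => {x : ℚ | ∃ m : ℤ, x = (uhfSeq enum N n : ℚ)⁻¹ * m})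
        hk)
  · obtain ⟨n, hn⟩ := exists_uhfSeq_dvd enum hdvd hN k
    exact (setOf_inv_mul_subset (hr n) hn).trans
      (Set.subset_iUnion (fun n : ℕ => {x : ℚ | ∃ m : ℤ, x = (r n : ℚ)⁻¹ * m}) n)

/-! ### Spatial `L^p` UHF algebras -/

theorem K0.map_idemClass {A B : Type*} [NonUnitalNormedRing A] [NormedSpace ℂ A]
    [IsScalarTower ℂ A A] [SMulCommClass ℂ A A] [NonUnitalNormedRing B] [NormedSpace ℂ B]
    [IsScalarTower ℂ B B] [SMulCommClass ℂ B B] (φ : ContrHom A B) (a : A) (ha : a * a = a)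
    (hb : φ a * φ a = φ a) : K0.map φ (K0.idemClass a ha) = K0.idemClass (φ a) hb := by
  refine Subtype.ext ((K00.map_of _ _).trans (congrArg _ (congrArg VMonoid.mk ?_)))
  simp only [IdemMatrix.map, IdemMatrix.single, IdemMatrix.mk.injEq, heq_eq_eq, true_and]
  ext i j : 2
  exact Plus.map_inr φ a

section UHF

variable {D : Type w} [NormedRing D] [NormedAlgebra ℂ D]

/-- The inclusion of a subalgebra. -/
def Subalgebra.contrHom (S : Subalgebra ℂ D) : ContrHom S D where
  toFun x := x
  map_smul' _ _ := rfl
  map_zero' := rfl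
  map_add' _ _ := rfl
  map_mul' _ _ := rfl
  norm_le _ := le_rfl

/-- The inclusion of a subalgebra in a larger one. -/
def Subalgebra.inclusionContrHom {S T : Subalgebra ℂ D} (h : S ≤ T) : ContrHom S T where
  toFun x := Subalgebra.inclusion h x
  map_smul' _ _ := rfl
  map_zero' := rfl
  map_add' _ _ := rfl
  map_mul' _ _ := rfl
  norm_le _ := le_rfl

variable {S : ℕ → Subalgebra ℂ D}

instance Subalgebra.directedSystem_inclusionContrHom (hS : Monotone S) :
    DirectedSystem (fun n => S n)
      (fun _ _ h => Subalgebra.inclusionContrHom (hS h)) where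
  map_self _ _ := rfl
  map_map _ _ _ _ _ _ := rfl

theorem Subalgebra.isBanachApproxLimit (hS : Monotone S)
    (hd : closure (⋃ n, (S n : Set D)) = Set.univ) :
    IsBanachApproxLimit (A := fun n => S n) (fun _ _ h => Subalgebra.inclusionContrHom (hS h))
      (fun n => Subalgebra.contrHom (S n)) where
  map_map _ _ _ _ _ _ := rfl
  compat _ _ _ _ := rfl
  dense y ε hε := by
    have hy : y ∈ closure (⋃ n, (S n : Set D)) := hd ▸ Set.mem_univ y
    obtain ⟨x, hx, hxy⟩ := Metric.mem_closure_iff.1 hy ε hε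
    obtain ⟨n, hn⟩ := Set.mem_iUnion.1 hx
    rw [dist_comm, dist_eq_norm] at hxy
    exact ⟨n, ⟨x, hn⟩, hxy⟩
  norm i a ε h := ⟨i, le_rfl, h⟩

/-- In an infinite cyclic group `σ(g)x = σ(x)g`, and one can divide by `σ(g)` in `ℚ`. This compares
the normalized traces at two stages by their value on `[1]` alone. -/
theorem addMonoidHom_rat_ext {G : Type*} [AddCommGroup G] (σ : G ≃+ ℤ) {g : G} (hg : σ g ≠ 0)
    {f f' : G →+ ℚ} (h : f g = f' g) : f = f' := by
  ext x
  have hx : σ g • x = σ x • g := σ.injective (by simp [mul_comm])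
  have h1 := congrArg f hx
  have h2 := congrArg f' hx
  simp only [map_zsmul, h] at h1 h2
  rw [← h2] at h1
  simpa [hg] using h1

/-- Each `K0 (S n)` is `ℤ` with `[1]` at `r n`; dividing by `r n` embeds it in `ℚ` with image
`r(n)⁻¹ℤ` and `[1]` at `1`. The embeddings are compatible because the inclusions preserve `[1]`, so
they glue to an injection of the limit. -/
theorem exists_K0_hom_of_subalgebras [CompleteSpace D] (hS : Monotone S)
    (hd : closure (⋃ n, (S n : Set D)) = Set.univ) {r : ℕ → ℕ}
    (hr : ∀ n, 0 < r n) (e : ∀ n, S n ≃ₐ[ℂ] Matrix (Fin (r n)) (Fin (r n)) ℂ) :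
    Subsingleton (K1 D) ∧ ∃ f : K0 D →+ ℚ, Function.Injective f ∧
      Set.range f = ⋃ n, {x : ℚ | ∃ m : ℤ, x = (r n : ℚ)⁻¹ * m} ∧
      f (K0.idemClass (1 : D) (one_mul 1)) = 1 := by
  have hfin : ∀ n, FiniteDimensional ℂ (S n) := fun n =>
    Module.Finite.equiv (e n).symm.toLinearEquiv
  have hcomp : ∀ n, CompleteSpace (S n) := fun n => FiniteDimensional.complete ℂ (S n)
  have H := Subalgebra.isBanachApproxLimit hS hd
  have hsys := Subalgebra.directedSystem_inclusionContrHom hS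
  let φ : ∀ i j, i ≤ j → ContrHom (S i) (S j) := fun _ _ h => Subalgebra.inclusionContrHom (hS h)
  let ψ : ∀ i, ContrHom (S i) D := fun n => Subalgebra.contrHom (S n)
  constructor
  · refine ⟨fun x y => ?_⟩
    have h1 : ∀ z : K1 D, z = 1 := by
      intro z
      obtain ⟨n, x, rfl⟩ := H.K1_exists_map_eq z
      rw [K1.eq_one_of_finiteDimensional x, map_one]
    rw [h1 x, h1 y]
  choose σ hσ using fun n => K0.exists_equiv_int (e n : S n ≃+* _) (hr n)
  have hr' : ∀ n, (r n : ℚ) ≠ 0 := fun n => by exact_mod_cast (hr n).ne'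
  let g : ∀ n, K0 (S n) →+ ℚ := fun n =>
    (AddMonoidHom.mulLeft (r n : ℚ)⁻¹).comp ((Int.castAddHom ℚ).comp (σ n : K0 (S n) →+ ℤ))
  have hg : ∀ n x, g n x = (r n : ℚ)⁻¹ * (σ n x : ℤ) := fun n x => rfl
  have hg1 : ∀ n, g n (K0.idemClass 1 (one_mul 1)) = 1 := fun n => by
    rw [hg, hσ]
    exact inv_mul_cancel₀ (hr' n)
  have hginj : ∀ n, Function.Injective (g n) := by
    intro n x y h
    rw [hg, hg] at h
    exact (σ n).injective (by simpa [hr' n] using h)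
  have hgc : ∀ i j (h : i ≤ j) (x : K0 (S i)), g i x = g j (K0.map (φ i j h) x) := by
    intro i j h x
    have : g i = (g j).comp (K0.map (φ i j h)) := by
      refine addMonoidHom_rat_ext (σ i) (g := K0.idemClass 1 (one_mul 1)) ?_ ?_
      · rw [hσ]
        exact_mod_cast (hr i).ne'
      · exact (hg1 i).trans ((congrArg (g j)
          (K0.map_idemClass (φ i j h) 1 (one_mul 1) (one_mul 1))).trans (hg1 j)).symm
    exact DFunLike.congr_fun this x
  let Φ := AddEquiv.ofBijective (K0.limMap φ ψ H.compat) H.bijective_K0_limMap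
  let F : DirectLimit (fun i => K0 (S i)) (fun i j h => K0.map (φ i j h)) →+ ℚ :=
    { toFun := DirectLimit.lift _ (fun n => g n) hgc
      map_zero' := DirectLimit.lift_zero g _
      map_add' := DirectLimit.lift_add g _ }
  have hF : Function.Injective F := by
    exact DirectLimit.lift_injective _ (fun n => g n) hgc hginj
  let f : K0 D →+ ℚ := F.comp (Φ.symm : K0 D →+ _)
  have hfψ : ∀ n x, f (K0.map (ψ n) x) = g n x := by
    intro n x
    have : Φ (Quotient.mk _ ⟨n, x⟩) = K0.map (ψ n) x := rfl
    change F (Φ.symm _) = _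
    rw [← this, AddEquiv.symm_apply_apply]
    rfl
  refine ⟨f, hF.comp Φ.symm.injective, ?_, ?_⟩
  · ext q
    simp only [Set.mem_range, Set.mem_iUnion, Set.mem_ofPred_eq]
    constructor
    · rintro ⟨z, rfl⟩
      obtain ⟨n, x, rfl⟩ := H.K0_exists_map_eq z
      exact ⟨n, σ n x, hfψ n x⟩
    · rintro ⟨n, m, rfl⟩
      refine ⟨K0.map (ψ n) ((σ n).symm m), ?_⟩
      rw [hfψ, hg, AddEquiv.apply_symm_apply]
  · have h1 := hfψ 0 (K0.idemClass 1 (one_mul 1))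
    rw [hg1, K0.map_idemClass (ψ 0) 1 (one_mul 1) (one_mul 1)] at h1
    exact h1

end UHF

end

theorem mainTheorem11 :
    (∀ (I : Type v) [Preorder I] [IsDirectedOrder I] [Nonempty I]
      (A : I → Type u) [∀ i, NonUnitalNormedRing (A i)] [∀ i, NormedSpace ℂ (A i)]
      [∀ i, IsScalarTower ℂ (A i) (A i)] [∀ i, SMulCommClass ℂ (A i) (A i)]
      [∀ i, CompleteSpace (A i)]
      (φ : ∀ i j, i ≤ j → ContrHom (A i) (A j)) [DirectedSystem A (fun i j h => φ i j h)],
      (∃ (L : Type (max u v)) (_ : NonUnitalNormedRing L) (_ : NormedSpace ℂ L)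
        (_ : IsScalarTower ℂ L L) (_ : SMulCommClass ℂ L L) (_ : CompleteSpace L)
        (ψ : ∀ i, ContrHom (A i) L), IsBanachDirectLimit φ L ψ) ∧
      ∀ (L : Type (max u v)) [NonUnitalNormedRing L] [NormedSpace ℂ L]
        [IsScalarTower ℂ L L] [SMulCommClass ℂ L L] [CompleteSpace L]
        (ψ : ∀ i, ContrHom (A i) L) (hL : IsBanachDirectLimit φ L ψ),
        Function.Bijective (K0.limMap φ ψ hL.compat) ∧
        Function.Bijective (K1.limMap φ ψ hL.compat)) ∧
    (∀ (enum : ℕ ≃ Nat.Primes) (N : Nat.Primes → ℕ∞), ∑' t, N t = ⊤ →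
      ∀ (p : ℝ≥0∞) [Fact (1 ≤ p)] (D : Type w) [NormedRing D] [NormedAlgebra ℂ D]
        [CompleteSpace D], IsSpatialUHF p N D →
        Subsingleton (K1 D) ∧
        ∃ f : K0 D →+ ℚ, Function.Injective f ∧
          Set.range f = ⋃ n ∈ Set.Ici 1, {x : ℚ | ∃ m : ℤ, x = (uhfSeq enum N n : ℚ)⁻¹ * m} ∧
          f (K0.idemClass (1 : D) (one_mul 1)) = 1) := by
  refine ⟨?_, ?_⟩
  · intro I _ _ _ A _ _ _ _ _ φ _
    refine ⟨?_, ?_⟩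
    · obtain ⟨L, i₁, i₂, i₃, i₄, i₅, ψ, hL, -⟩ := exists_isBanachDirectLimit φ
      exact ⟨L, i₁, i₂, i₃, i₄, i₅, ψ, hL⟩
    · intro L _ _ _ _ _ ψ hL
      exact ⟨hL.isBanachApproxLimit.bijective_K0_limMap, hL.isBanachApproxLimit.bijective_K1_limMap⟩
  · rintro enum N - p _ D _ _ _ ⟨r, -, hr, hdvd, hN, S, hS, hd, he⟩
    choose e _ using he
    obtain ⟨hK1, f, hf, hrange, hf1⟩ := exists_K0_hom_of_subalgebras hS hd hr
      fun n => (e n).trans (nonempty_matrixLp_algEquiv p (hr n)).some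
    exact ⟨hK1, f, hf, hrange.trans (iUnion_inv_mul_eq enum hr hdvd hN), hf1⟩
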